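/- Let $k$ be a commutative ring. All algebras are associative unital $k$-algebras, and bimodules are $k$-symmetric, i.e. $k$ acts centrally. For a $k$-algebra $A$, an $A$-coring is an $A$-bimodule $C$ with $A$-bimodule maps $\Delta : C \to C\otimes_A C$ and $\epsilon : C \to A$ such that $(C\otimes_A\Delta)\Delta = (\Delta\otimes_A C)\Delta$ and, up to the canonical isomorphisms, $(C\otimes_A\epsilon)\Delta = C = (\epsilon\otimes_A C)\Delta$. The algebra $A$ is separable over $k$ if there is an $A$-bimodule map $\theta : A \to A\otimes_k A$ with $\mu\theta = \mathrm{id}_A$, where $\mu$ is the multiplication. An $A$-coring $C$ is coseparable if there is a homomorphism of $C$-bicomodules $\pi : C\otimes_A C\to C$ with $\pi\Delta=\mathrm{id}_C$, where $C\otimes_A C$ has the left coaction $\Delta\otimes_A C$ and the right coaction $C\otimes_A\Delta$. A comodule is simple if it has exactly two subcomodules, and semisimple if it is a direct sum of simple subcomodules. An $A$-coring $C$ is semisimple if ${}_AC$ is flat and $C$ is semisimple as a right $C$-comodule. If $C$ is an $A$-coring and $D$ is a $B$-coring, then $C\otimes_k D$ is an $A\otimes_k B$-coring with counit $\epsilon_C\otimes\epsilon_D$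 and comultiplication $$C\otimes_k D \xrightarrow{\Delta_C\otimes\Delta_D} (C\otimes_A C)\otimes_k(D\otimes_B D)\cong (C\otimes_k D)\otimes_{A\otimes_k B}(C\otimes_k D).$$ **Theorem.** Let $A$ be a separable $k$-algebra and let $C$ be a coseparable $A$-coring such that ${}_AC$ is flat. Then for every $k$-algebra $B$ and every semisimple $B$-coring $D$, the $A\otimes_k B$-coring $C\otimes_k D$ is semisimple. -/

import Mathlib

open scoped TensorProduct
open MulOpposite

universe u v

set_option linter.unusedSectionVars false

/-! ## Tensor products over noncommutative algebras

Right `A`-modules are modules over `Aᵐᵒᵖ`. For a right `A`-module `M` and a left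
`A`-module `N`, the `k`-module `M ⊗_A N` is the quotient of `M ⊗[k] N` by the elements
`(m · a) ⊗ n - m ⊗ (a · n)`. -/

noncomputable section

section BalancedTensor

variable (k : Type*) [CommRing k] (A : Type*) [Ring A]
variable (M : Type*) [AddCommGroup M] [Module k M] [Module Aᵐᵒᵖ M]
variable (N : Type*) [AddCommGroup N] [Module k N] [Module A N]

/-- The `k`-submodule of `M ⊗[k] N` generated by all `(m · a) ⊗ n - m ⊗ (a · n)`. -/
def balancedRel : Submodule k (M ⊗[k] N) :=
  Submodule.span k {x | ∃ (m : M) (a : A) (n : N), x = (op a • m) ⊗ₜ[k] n - m ⊗ₜ[k] (a • n)}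

/-- The tensor product `M ⊗_A N` of a right `A`-module `M` and a left `A`-module `N`. -/
def BalTensor : Type _ := (M ⊗[k] N) ⧸ balancedRel k A M N

instance : AddCommGroup (BalTensor k A M N) :=
  inferInstanceAs (AddCommGroup ((M ⊗[k] N) ⧸ balancedRel k A M N))

instance : Module k (BalTensor k A M N) :=
  inferInstanceAs (Module k ((M ⊗[k] N) ⧸ balancedRel k A M N))

end BalancedTensor

namespace BalTensor

section Basic

variable {k : Type*} [CommRing k] (A : Type*) [Ring A]
variable {M : Type*} [AddCommGroup M] [Module k M] [Module Aᵐᵒᵖ M]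
variable {N : Type*} [AddCommGroup N] [Module k N] [Module A N]
variable {M' : Type*} [AddCommGroup M'] [Module k M'] [Module Aᵐᵒᵖ M']
variable {N' : Type*} [AddCommGroup N'] [Module k N'] [Module A N']
variable {P : Type*} [AddCommGroup P] [Module k P]

/-- The projection `M ⊗[k] N → M ⊗_A N`. -/
def mk : M ⊗[k] N →ₗ[k] BalTensor k A M N := (balancedRel k A M N).mkQ

variable (k) in
/-- The pure tensor `m ⊗_A n`. -/
def tmul (m : M) (n : N) : BalTensor k A M N := mk A (m ⊗ₜ[k] n)

variable {A}

theorem smul_tmul (a : A) (m : M) (n : N) :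
    tmul k A (op a • m) n = tmul k A m (a • n) := by
  refine (Submodule.Quotient.eq _).2 (Submodule.subset_span ⟨m, a, n, rfl⟩)

theorem tmul_add (m : M) (n n' : N) : tmul k A m (n + n') = tmul k A m n + tmul k A m n' := by
  simp [tmul, TensorProduct.tmul_add]

theorem add_tmul (m m' : M) (n : N) : tmul k A (m + m') n = tmul k A m n + tmul k A m' n := by
  simp [tmul, TensorProduct.add_tmul]

@[elab_as_elim]
theorem induction_on {motive : BalTensor k A M N → Prop} (x : BalTensor k A M N)
    (zero : motive 0) (tmul : ∀ m n, motive (tmul k A m n))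
    (add : ∀ x y, motive x → motive y → motive (x + y)) : motive x := by
  obtain ⟨t, rfl⟩ := Submodule.Quotient.mk_surjective _ x
  induction t using TensorProduct.induction_on with
  | zero => exact zero
  | tmul m n => exact tmul m n
  | add x y hx hy => exact add _ _ hx hy

/-- The universal property of `M ⊗_A N`. -/
def lift (f : M →ₗ[k] N →ₗ[k] P) (hf : ∀ (a : A) m n, f (op a • m) n = f m (a • n)) :
    BalTensor k A M N →ₗ[k] P :=
  (balancedRel k A M N).liftQ (TensorProduct.lift f) (by
    refine Submodule.span_le.2 ?_
    rintro _ ⟨m, a, n, rfl⟩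
    simp [hf])

@[simp]
theorem lift_tmul (f : M →ₗ[k] N →ₗ[k] P) (hf : ∀ (a : A) m n, f (op a • m) n = f m (a • n))
    (m : M) (n : N) : lift f hf (tmul k A m n) = f m n := by
  exact (Submodule.liftQ_apply _ _ _).trans (TensorProduct.lift.tmul _ _)

theorem hom_ext {f g : BalTensor k A M N →ₗ[k] P}
    (h : ∀ m n, f (tmul k A m n) = g (tmul k A m n)) : f = g := by
  ext x
  induction x using induction_on with
  | zero => simp
  | tmul m n => exact h m n
  | add x y hx hy => simp [hx, hy]

/-- The map `f ⊗_A g`, for `f` right `A`-linear and `g` left `A`-linear. -/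
def map (f : M →ₗ[k] M') (g : N →ₗ[k] N') (hf : ∀ (a : A) m, f (op a • m) = op a • f m)
    (hg : ∀ (a : A) n, g (a • n) = a • g n) : BalTensor k A M N →ₗ[k] BalTensor k A M' N' :=
  lift ((TensorProduct.mk k M' N').compr₂ (mk A) |>.compl₁₂ f g) (fun a m n => by
    have := smul_tmul (k := k) a (f m) (g n)
    simpa [hf, hg, tmul] using this)

@[simp]
theorem map_tmul (f : M →ₗ[k] M') (g : N →ₗ[k] N') (hf : ∀ (a : A) m, f (op a • m) = op a • f m)
    (hg : ∀ (a : A) n, g (a • n) = a • g n) (m : M) (n : N) :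
    map f g hf hg (tmul k A m n) = tmul k A (f m) (g n) := by
  simp only [map, lift_tmul]
  rfl

/-- The identity is right `A`-linear, in the form used by `map`. -/
theorem id_rsmul (a : A) (m : M) :
    (LinearMap.id : M →ₗ[k] M) (op a • m) = op a • (LinearMap.id : M →ₗ[k] M) m := rfl

/-- The identity is left `A`-linear, in the form used by `map`. -/
theorem id_lsmul (a : A) (n : N) :
    (LinearMap.id : N →ₗ[k] N) (a • n) = a • (LinearMap.id : N →ₗ[k] N) n := rfl

theorem tmul_smul (c : k) (m : M) (n : N) : tmul k A m (c • n) = c • tmul k A m n := by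
  simp only [tmul, TensorProduct.tmul_smul, map_smul]

theorem smul_tmul' (c : k) (m : M) (n : N) : tmul k A (c • m) n = c • tmul k A m n := by
  simp only [tmul, ← TensorProduct.smul_tmul', map_smul]

@[simp]
theorem tmul_zero (m : M) : tmul k A m (0 : N) = 0 := by
  simp only [tmul, TensorProduct.tmul_zero, map_zero]

@[simp]
theorem zero_tmul (n : N) : tmul k A (0 : M) n = 0 := by
  simp only [tmul, TensorProduct.zero_tmul, map_zero]

end Basic

section LeftModule

variable {k : Type*} [CommRing k] {A : Type*} [Ring A] [Algebra k A]
variable {M : Type*} [AddCommGroup M] [Module k M] [Module A M] [Module Aᵐᵒᵖ M]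
  [SMulCommClass A Aᵐᵒᵖ M] [IsScalarTower k A M]
variable {N : Type*} [AddCommGroup N] [Module k N] [Module A N]

/-- If `M` is an `A`-bimodule then `M ⊗_A N` is a left `A`-module: `a (m ⊗ n) = (a m) ⊗ n`. -/
instance : Module A (BalTensor k A M N) where
  smul a := map (Algebra.lsmul k k M a) LinearMap.id
    (fun b m => by simpa using smul_comm a (op b) m) (fun _ _ => rfl)
  one_smul x := LinearMap.congr_fun (f := map (Algebra.lsmul k k M (1 : A)) LinearMap.id _ _)
    (g := LinearMap.id) (hom_ext fun m n => by simp) x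
  mul_smul a b x := LinearMap.congr_fun
    (f := map (Algebra.lsmul k k M (a * b)) LinearMap.id _ _)
    (g := map (Algebra.lsmul k k M a) LinearMap.id
        (fun b m => by simpa using smul_comm a (op b) m) (fun _ _ => rfl) ∘ₗ
      map (Algebra.lsmul k k M b) LinearMap.id
        (fun a m => by simpa using smul_comm b (op a) m) (fun _ _ => rfl))
    (hom_ext fun m n => by simp) x
  smul_zero a := map_zero _
  smul_add a := map_add _
  add_smul a b x := LinearMap.congr_fun
    (f := map (Algebra.lsmul k k M (a + b)) LinearMap.id _ _)
    (g := map (Algebra.lsmul k k M a) LinearMap.id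
        (fun b m => by simpa using smul_comm a (op b) m) (fun _ _ => rfl) +
      map (Algebra.lsmul k k M b) LinearMap.id
        (fun a m => by simpa using smul_comm b (op a) m) (fun _ _ => rfl))
    (hom_ext fun m n => by simp [add_tmul]) x
  zero_smul x := LinearMap.congr_fun
    (f := map (Algebra.lsmul k k M (0 : A)) LinearMap.id _ _) (g := 0)
    (hom_ext fun m n => by simp) x

@[simp]
theorem lsmul_tmul (a : A) (m : M) (n : N) : a • tmul k A m n = tmul k A (a • m) n :=
  map_tmul _ _ _ _ _ _

instance : IsScalarTower k A (BalTensor k A M N) where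
  smul_assoc c a x := by
    induction x using induction_on with
    | zero => simp
    | tmul m n => simp only [lsmul_tmul, smul_assoc, smul_tmul']
    | add x y hx hy => simp only [smul_add, hx, hy]

end LeftModule

section RightModule

variable {k : Type*} [CommRing k] {A : Type*} [Ring A] [Algebra k A]
variable {M : Type*} [AddCommGroup M] [Module k M] [Module Aᵐᵒᵖ M]
variable {N : Type*} [AddCommGroup N] [Module k N] [Module A N] [Module Aᵐᵒᵖ N]
  [SMulCommClass A Aᵐᵒᵖ N] [IsScalarTower k Aᵐᵒᵖ N]

/-- If `N` is an `A`-bimodule then `M ⊗_A N` is a right `A`-module: `(m ⊗ n) a = m ⊗ (n a)`. -/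
instance : Module Aᵐᵒᵖ (BalTensor k A M N) where
  smul a := map LinearMap.id (Algebra.lsmul k k N a) (fun _ _ => rfl)
    (fun b n => by simpa using (smul_comm b a n).symm)
  one_smul x := LinearMap.congr_fun (f := map LinearMap.id (Algebra.lsmul k k N (1 : Aᵐᵒᵖ)) _ _)
    (g := LinearMap.id) (hom_ext fun m n => by simp) x
  mul_smul a b x := LinearMap.congr_fun
    (f := map LinearMap.id (Algebra.lsmul k k N (a * b)) _ _)
    (g := map LinearMap.id (Algebra.lsmul k k N a) (fun _ _ => rfl)
        (fun b n => by simpa using (smul_comm b a n).symm) ∘ₗ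
      map LinearMap.id (Algebra.lsmul k k N b) (fun _ _ => rfl)
        (fun a n => by simpa using (smul_comm a b n).symm))
    (hom_ext fun m n => by simp) x
  smul_zero a := map_zero _
  smul_add a := map_add _
  add_smul a b x := LinearMap.congr_fun
    (f := map LinearMap.id (Algebra.lsmul k k N (a + b)) _ _)
    (g := map LinearMap.id (Algebra.lsmul k k N a) (fun _ _ => rfl)
        (fun b n => by simpa using (smul_comm b a n).symm) +
      map LinearMap.id (Algebra.lsmul k k N b) (fun _ _ => rfl)
        (fun a n => by simpa using (smul_comm a b n).symm))
    (hom_ext fun m n => by simp [tmul_add]) x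
  zero_smul x := LinearMap.congr_fun
    (f := map LinearMap.id (Algebra.lsmul k k N (0 : Aᵐᵒᵖ)) _ _) (g := 0)
    (hom_ext fun m n => by simp) x

@[simp]
theorem rsmul_tmul (a : Aᵐᵒᵖ) (m : M) (n : N) : a • tmul k A m n = tmul k A m (a • n) :=
  map_tmul _ _ _ _ _ _

instance : IsScalarTower k Aᵐᵒᵖ (BalTensor k A M N) where
  smul_assoc c a x := by
    induction x using induction_on with
    | zero => simp
    | tmul m n => simp only [rsmul_tmul, smul_assoc, tmul_smul]
    | add x y hx hy => simp only [smul_add, hx, hy]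

instance [Module A M] [SMulCommClass A Aᵐᵒᵖ M] [IsScalarTower k A M] :
    SMulCommClass A Aᵐᵒᵖ (BalTensor k A M N) where
  smul_comm a b x := by
    induction x using induction_on with
    | zero => simp
    | tmul m n => simp only [rsmul_tmul, lsmul_tmul]
    | add x y hx hy => simp only [smul_add, hx, hy]

end RightModule

section Canonical

variable (k : Type*) [CommRing k] (A : Type*) [Ring A] [Algebra k A]

/-- The canonical map `M ⊗_A A → M`, `m ⊗ a ↦ m a`. -/
def rid (M : Type*) [AddCommGroup M] [Module k M] [Module Aᵐᵒᵖ M] [IsScalarTower k Aᵐᵒᵖ M] :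
    BalTensor k A M A →ₗ[k] M :=
  lift (((Algebra.lsmul k k M).toLinearMap ∘ₗ (opLinearEquiv k).toLinearMap).flip)
    (by intro a m n; simp)

/-- The canonical map `A ⊗_A M → M`, `a ⊗ m ↦ a m`. -/
def lid (M : Type*) [AddCommGroup M] [Module k M] [Module A M] [IsScalarTower k A M] :
    BalTensor k A A M →ₗ[k] M :=
  lift (Algebra.lsmul k k M).toLinearMap (by intro a m n; simp)

@[simp]
theorem rid_tmul {M : Type*} [AddCommGroup M] [Module k M] [Module Aᵐᵒᵖ M]
    [IsScalarTower k Aᵐᵒᵖ M] (m : M) (a : A) : rid k A M (tmul k A m a) = op a • m := by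
  exact lift_tmul _ _ _ _

@[simp]
theorem lid_tmul {M : Type*} [AddCommGroup M] [Module k M] [Module A M]
    [IsScalarTower k A M] (a : A) (m : M) : lid k A M (tmul k A a m) = a • m := by
  exact lift_tmul _ _ _ _

variable {M : Type*} [AddCommGroup M] [Module k M] [Module Aᵐᵒᵖ M]
variable {N : Type*} [AddCommGroup N] [Module k N] [Module A N] [Module Aᵐᵒᵖ N]
  [SMulCommClass A Aᵐᵒᵖ N] [IsScalarTower k A N] [IsScalarTower k Aᵐᵒᵖ N]
variable {P : Type*} [AddCommGroup P] [Module k P] [Module A P]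

/-- The map `n ⊗ p ↦ (m ⊗ n) ⊗ p`. -/
def assocInvAux (m : M) : BalTensor k A N P →ₗ[k] BalTensor k A (BalTensor k A M N) P :=
  map ⟨⟨tmul k A m, tmul_add m⟩, fun c n => tmul_smul c m n⟩ LinearMap.id
    (fun a n => (rsmul_tmul (op a) m n).symm) (fun _ _ => rfl)

/-- The map `m ⊗ n ↦ m ⊗ (n ⊗ p)`. -/
def assocAux (p : P) : BalTensor k A M N →ₗ[k] BalTensor k A M (BalTensor k A N P) :=
  map LinearMap.id ⟨⟨fun n => tmul k A n p, fun n n' => add_tmul n n' p⟩,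
    fun c n => smul_tmul' c n p⟩ (fun _ _ => rfl) (fun a n => (lsmul_tmul a n p).symm)

theorem assocInvAux_tmul (m : M) (n : N) (p : P) :
    assocInvAux k A m (tmul k A n p) = tmul k A (tmul k A m n) p := map_tmul _ _ _ _ _ _

theorem assocAux_tmul (m : M) (n : N) (p : P) :
    assocAux k A p (tmul k A m n) = tmul k A m (tmul k A n p) := map_tmul _ _ _ _ _ _

variable (M N P)

/-- The associativity isomorphism `(M ⊗_A N) ⊗_A P ≃ M ⊗_A (N ⊗_A P)`. -/
def assoc : BalTensor k A (BalTensor k A M N) P ≃ₗ[k] BalTensor k A M (BalTensor k A N P) :=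
  LinearEquiv.ofLinearMap
    (lift (LinearMap.mk₂ k (fun x p => assocAux k A p x)
        (fun _ _ _ => map_add _ _ _)
        (fun _ _ _ => map_smul _ _ _)
        (fun x p p' => by
          induction x using induction_on with
          | zero => simp
          | tmul m n => simp only [assocAux_tmul, tmul_add]
          | add x y hx hy => simp only [map_add, hx, hy]; abel)
        (fun c x p => by
          induction x using induction_on with
          | zero => simp
          | tmul m n => simp only [assocAux_tmul, tmul_smul]
          | add x y hx hy => simp only [map_add, hx, hy, smul_add]))
      (by
        intro a x p
        simp only [LinearMap.mk₂_apply]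
        induction x using induction_on with
        | zero => simp
        | tmul m n => simp only [assocAux_tmul, rsmul_tmul, smul_tmul]
        | add x y hx hy => simp only [map_add, hx, hy, smul_add]))
    (lift (LinearMap.mk₂ k (fun m x => assocInvAux k A m x)
        (fun m m' x => by
          induction x using induction_on with
          | zero => simp
          | tmul n p => simp only [assocInvAux_tmul, add_tmul]
          | add x y hx hy => simp only [map_add, hx, hy]; abel)
        (fun c m x => by
          induction x using induction_on with
          | zero => simp
          | tmul n p => simp only [assocInvAux_tmul, smul_tmul']
          | add x y hx hy => simp only [map_add, hx, hy, smul_add])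
        (fun _ _ _ => map_add _ _ _)
        (fun _ _ _ => map_smul _ _ _))
      (by
        intro a m x
        simp only [LinearMap.mk₂_apply]
        induction x using induction_on with
        | zero => simp
        | tmul n p => simp only [assocInvAux_tmul, lsmul_tmul, smul_tmul]
        | add x y hx hy => simp only [map_add, hx, hy, smul_add]))
    (hom_ext fun m x => by
      induction x using induction_on with
      | zero => simp
      | tmul n p => simp [assocInvAux_tmul, assocAux_tmul]
      | add x y hx hy => simp only [tmul_add, map_add, hx, hy])
    (hom_ext fun x p => by
      induction x using induction_on with
      | zero => simp
      | tmul m n => simp [assocInvAux_tmul, assocAux_tmul]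
      | add x y hx hy => simp only [add_tmul, map_add, hx, hy])

variable {M N P}

@[simp]
theorem assoc_tmul (m : M) (n : N) (p : P) :
    assoc k A M N P (tmul k A (tmul k A m n) p) = tmul k A m (tmul k A n p) := by
  exact assocAux_tmul k A m n p

@[simp]
theorem assoc_symm_tmul (m : M) (n : N) (p : P) :
    (assoc k A M N P).symm (tmul k A m (tmul k A n p)) = tmul k A (tmul k A m n) p := by
  rw [LinearEquiv.symm_apply_eq, assoc_tmul]

end Canonical

end BalTensor

/-! ## Corings -/

/-- An `A`-coring structure on the `A`-bimodule `C`: a coassociative and counital pair of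
`A`-bimodule maps `Δ : C → C ⊗_A C` and `ε : C → A`. -/
structure Coring (k : Type*) [CommRing k] (A : Type*) [Ring A] [Algebra k A]
    (C : Type*) [AddCommGroup C] [Module k C] [Module A C] [Module Aᵐᵒᵖ C]
    [SMulCommClass A Aᵐᵒᵖ C] [IsScalarTower k A C] [IsScalarTower k Aᵐᵒᵖ C] where
  /-- The comultiplication `Δ`. -/
  comul : C →ₗ[k] BalTensor k A C C
  comul_lsmul : ∀ (a : A) (c : C), comul (a • c) = a • comul c
  comul_rsmul : ∀ (a : A) (c : C), comul (op a • c) = op a • comul c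
  /-- The counit `ε`. -/
  counit : C →ₗ[k] A
  counit_lsmul : ∀ (a : A) (c : C), counit (a • c) = a • counit c
  counit_rsmul : ∀ (a : A) (c : C), counit (op a • c) = op a • counit c
  /-- `(C ⊗ Δ) Δ = (Δ ⊗ C) Δ` -/
  coassoc : ∀ c : C, BalTensor.map LinearMap.id comul BalTensor.id_rsmul comul_lsmul (comul c) =
    BalTensor.assoc k A C C C
      (BalTensor.map comul LinearMap.id comul_rsmul BalTensor.id_lsmul (comul c))
  /-- `(C ⊗ ε) Δ = C` -/
  rid_comul : ∀ c : C, BalTensor.rid k A C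
    (BalTensor.map LinearMap.id counit BalTensor.id_rsmul counit_lsmul (comul c)) = c
  /-- `(ε ⊗ C) Δ = C` -/
  lid_comul : ∀ c : C, BalTensor.lid k A C
    (BalTensor.map counit LinearMap.id counit_rsmul BalTensor.id_lsmul (comul c)) = c

section Definitions

variable {k : Type*} [CommRing k] {A : Type*} [Ring A] [Algebra k A]
variable {C : Type*} [AddCommGroup C] [Module k C] [Module A C] [Module Aᵐᵒᵖ C]
  [SMulCommClass A Aᵐᵒᵖ C] [IsScalarTower k A C] [IsScalarTower k Aᵐᵒᵖ C]

/-- `A` is a separable `k`-algebra: the multiplication `A ⊗[k] A → A` has a section `θ` that is a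
homomorphism of `A`-bimodules, where `a (x ⊗ y) b = (a x) ⊗ (y b)`. -/
def IsSeparableAlgebra (k : Type*) [CommRing k] (A : Type*) [Ring A] [Algebra k A] : Prop :=
  ∃ θ : A →ₗ[k] A ⊗[k] A,
    (∀ a x b : A, θ (a * x * b) = (a ⊗ₜ[k] 1) * θ x * (1 ⊗ₜ[k] b)) ∧
    ∀ x : A, LinearMap.mul' k A (θ x) = x

/-- The left `A`-module `N` is flat: `- ⊗_A N` preserves injectivity of right `A`-linear maps. -/
def IsLeftFlat (k : Type*) [CommRing k] (A : Type u) [Ring A] [Algebra k A]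
    (N : Type v) [AddCommGroup N] [Module k N] [Module A N] : Prop :=
  ∀ (X Y : Type (max u v)) [AddCommGroup X] [AddCommGroup Y] [Module k X] [Module k Y]
    [Module Aᵐᵒᵖ X] [Module Aᵐᵒᵖ Y] [IsScalarTower k Aᵐᵒᵖ X] [IsScalarTower k Aᵐᵒᵖ Y]
    (f : X →ₗ[k] Y) (hf : ∀ (a : A) (x : X), f (op a • x) = op a • f x),
    Function.Injective f →
      Function.Injective (BalTensor.map f (LinearMap.id : N →ₗ[k] N) hf BalTensor.id_lsmul)

/-- A right comodule structure over the coring `𝒞` on the right `A`-module `M`. -/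
structure RightComodule (𝒞 : Coring k A C) (M : Type*) [AddCommGroup M] [Module k M]
    [Module Aᵐᵒᵖ M] [IsScalarTower k Aᵐᵒᵖ M] where
  /-- The coaction `ρ`. -/
  coact : M →ₗ[k] BalTensor k A M C
  coact_rsmul : ∀ (a : A) (m : M), coact (op a • m) = op a • coact m
  /-- `(M ⊗ Δ) ρ = (ρ ⊗ C) ρ` -/
  coassoc : ∀ m : M,
    BalTensor.map LinearMap.id 𝒞.comul BalTensor.id_rsmul 𝒞.comul_lsmul (coact m) =
      BalTensor.assoc k A M C C
        (BalTensor.map coact LinearMap.id coact_rsmul BalTensor.id_lsmul (coact m))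
  /-- `(M ⊗ ε) ρ = M` -/
  rid_coact : ∀ m : M, BalTensor.rid k A M
    (BalTensor.map LinearMap.id 𝒞.counit BalTensor.id_rsmul 𝒞.counit_lsmul (coact m)) = m

namespace RightComodule

variable {𝒞 : Coring k A C} {M : Type*} [AddCommGroup M] [Module k M]
  [Module Aᵐᵒᵖ M] [IsScalarTower k Aᵐᵒᵖ M]

theorem subtype_rsmul (N : Submodule Aᵐᵒᵖ M) (a : A) (n : N) :
    (N.subtype.restrictScalars k) (op a • n) = op a • (N.subtype.restrictScalars k) n := rfl

/-- The `A`-submodule `N` of `M` is a subcomodule: `ρ N` lies in the image of `N ⊗_A C` in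
`M ⊗_A C`. When `C` is flat as a left `A`-module, the map `N ⊗_A C → M ⊗_A C` is injective, and
this says that `N` has a (unique) comodule structure for which the inclusion is a comodule map. -/
def IsSubcomodule (ρ : RightComodule 𝒞 M) (N : Submodule Aᵐᵒᵖ M) : Prop :=
  ∀ m ∈ N, ρ.coact m ∈ LinearMap.range
    (BalTensor.map (A := A) (N.subtype.restrictScalars k) (LinearMap.id : C →ₗ[k] C)
      (subtype_rsmul N) BalTensor.id_lsmul)

/-- `N` is a simple subcomodule of `M`: it has exactly two subcomodules, `0` and `N ≠ 0`. -/
def IsSimpleSubcomodule (ρ : RightComodule 𝒞 M) (N : Submodule Aᵐᵒᵖ M) : Prop :=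
  ρ.IsSubcomodule N ∧ N ≠ ⊥ ∧ ∀ L ≤ N, ρ.IsSubcomodule L → L = ⊥ ∨ L = N

/-- `M` is a semisimple comodule: it is the direct sum of a family of simple subcomodules. -/
def IsSemisimple (ρ : RightComodule 𝒞 M) : Prop :=
  ∃ S : Set (Submodule Aᵐᵒᵖ M), (∀ N ∈ S, ρ.IsSimpleSubcomodule N) ∧ sSupIndep S ∧ sSup S = ⊤

end RightComodule

namespace Coring

/-- A coring as a right comodule over itself. -/
def regular (𝒞 : Coring k A C) : RightComodule 𝒞 C where
  coact := 𝒞.comul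
  coact_rsmul := 𝒞.comul_rsmul
  coassoc := 𝒞.coassoc
  rid_coact := 𝒞.rid_comul

/-- The `A`-coring `C` is semisimple: `C` is flat as a left `A`-module and semisimple as a right
`C`-comodule. -/
def IsSemisimple (𝒞 : Coring k A C) : Prop :=
  IsLeftFlat k A C ∧ 𝒞.regular.IsSemisimple

/-- The `A`-coring `C` is coseparable: there is a homomorphism of `C`-bicomodules
`π : C ⊗_A C → C` with `π Δ = C`. Here `C ⊗_A C` has the left coaction `Δ ⊗ C` and the right
coaction `C ⊗ Δ`. -/
def IsCoseparable (𝒞 : Coring k A C) : Prop :=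
  ∃ (π : BalTensor k A C C →ₗ[k] C)
    (hl : ∀ (a : A) (x : BalTensor k A C C), π (a • x) = a • π x)
    (hr : ∀ (a : A) (x : BalTensor k A C C), π (op a • x) = op a • π x),
    (∀ x, 𝒞.comul (π x) = BalTensor.map LinearMap.id π BalTensor.id_rsmul hl
      (BalTensor.assoc k A C C C
        (BalTensor.map 𝒞.comul LinearMap.id 𝒞.comul_rsmul BalTensor.id_lsmul x))) ∧
    (∀ x, 𝒞.comul (π x) = BalTensor.map π LinearMap.id hr BalTensor.id_lsmul
      ((BalTensor.assoc k A C C C).symm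
        (BalTensor.map LinearMap.id 𝒞.comul BalTensor.id_rsmul 𝒞.comul_lsmul x))) ∧
    ∀ c, π (𝒞.comul c) = c

end Coring

end Definitions

/-! ## The tensor product of two corings -/

section TensorAction

variable (k : Type*) [CommRing k] (A : Type*) [Ring A] [Algebra k A]
  (B : Type*) [Ring B] [Algebra k B]

/-- The action of `A ⊗[k] B` on `C ⊗[k] D` by `(a ⊗ b) (c ⊗ d) = (a c) ⊗ (b d)`. -/
def tensorAct (C : Type*) [AddCommGroup C] [Module k C] [Module A C] [IsScalarTower k A C]
    (D : Type*) [AddCommGroup D] [Module k D] [Module B D] [IsScalarTower k B D] :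
    A ⊗[k] B →ₐ[k] Module.End k (C ⊗[k] D) :=
  Module.endTensorEndAlgHom.comp
    (Algebra.TensorProduct.map (Algebra.lsmul k k C) (Algebra.lsmul k k D))

variable {k A B}

section Left

variable {C : Type*} [AddCommGroup C] [Module k C] [Module A C] [IsScalarTower k A C]
  {D : Type*} [AddCommGroup D] [Module k D] [Module B D] [IsScalarTower k B D]

instance (priority := 50) tensorLeftModule : Module (A ⊗[k] B) (C ⊗[k] D) :=
  Module.compHom (C ⊗[k] D) (tensorAct k A B C D).toRingHom

theorem tensor_smul_def (t : A ⊗[k] B) (x : C ⊗[k] D) : t • x = tensorAct k A B C D t x := rfl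

@[simp]
theorem tensor_lsmul_tmul (a : A) (b : B) (c : C) (d : D) :
    (a ⊗ₜ[k] b) • (c ⊗ₜ[k] d) = (a • c) ⊗ₜ[k] (b • d) := rfl

instance (priority := 50) tensorLeftScalarTower :
    IsScalarTower k (A ⊗[k] B) (C ⊗[k] D) where
  smul_assoc r t x := by simp [tensor_smul_def]

end Left

section Right

variable {C : Type*} [AddCommGroup C] [Module k C] [Module Aᵐᵒᵖ C] [IsScalarTower k Aᵐᵒᵖ C]
  {D : Type*} [AddCommGroup D] [Module k D] [Module Bᵐᵒᵖ D] [IsScalarTower k Bᵐᵒᵖ D]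

/-- The right action `(c ⊗ d) (a ⊗ b) = (c a) ⊗ (d b)`. -/
instance (priority := 50) tensorRightModule : Module (A ⊗[k] B)ᵐᵒᵖ (C ⊗[k] D) :=
  Module.compHom (C ⊗[k] D) ((tensorAct k Aᵐᵒᵖ Bᵐᵒᵖ C D).comp
    (Algebra.TensorProduct.opAlgEquiv k k A B).symm.toAlgHom).toRingHom

theorem tensor_op_smul_def (t : (A ⊗[k] B)ᵐᵒᵖ) (x : C ⊗[k] D) :
    t • x = tensorAct k Aᵐᵒᵖ Bᵐᵒᵖ C D ((Algebra.TensorProduct.opAlgEquiv k k A B).symm t) x := rfl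

@[simp]
theorem tensor_rsmul_tmul (a : A) (b : B) (c : C) (d : D) :
    op (a ⊗ₜ[k] b) • (c ⊗ₜ[k] d) = (op a • c) ⊗ₜ[k] (op b • d) := by
  rw [tensor_op_smul_def, Algebra.TensorProduct.opAlgEquiv_symm_tmul]
  rfl

instance (priority := 50) tensorRightScalarTower :
    IsScalarTower k (A ⊗[k] B)ᵐᵒᵖ (C ⊗[k] D) where
  smul_assoc r t x := by
    rw [tensor_op_smul_def, tensor_op_smul_def, map_smul, map_smul, LinearMap.smul_apply]

end Right

instance (priority := 50) tensorSMulComm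
    {C : Type*} [AddCommGroup C] [Module k C] [Module A C] [Module Aᵐᵒᵖ C]
    [SMulCommClass A Aᵐᵒᵖ C] [IsScalarTower k A C] [IsScalarTower k Aᵐᵒᵖ C]
    {D : Type*} [AddCommGroup D] [Module k D] [Module B D] [Module Bᵐᵒᵖ D]
    [SMulCommClass B Bᵐᵒᵖ D] [IsScalarTower k B D] [IsScalarTower k Bᵐᵒᵖ D] :
    SMulCommClass (A ⊗[k] B) (A ⊗[k] B)ᵐᵒᵖ (C ⊗[k] D) where
  smul_comm s t x := by
    obtain ⟨t, rfl⟩ := op_surjective t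
    induction s using TensorProduct.induction_on with
    | zero => simp
    | add s s' hs hs' => simp only [add_smul, smul_add, hs, hs']
    | tmul a b =>
      induction t using TensorProduct.induction_on with
      | zero => simp
      | add s s' hs hs' => simp only [op_add, add_smul, smul_add, hs, hs']
      | tmul a' b' =>
        induction x using TensorProduct.induction_on with
        | zero => simp
        | add s s' hs hs' => simp only [smul_add, hs, hs']
        | tmul c d => simp [smul_comm]

end TensorAction

section Exchange

variable {k : Type*} [CommRing k] {A : Type*} [Ring A] [Algebra k A]
  {B : Type*} [Ring B] [Algebra k B]
variable {C : Type*} [AddCommGroup C] [Module k C] [Module Aᵐᵒᵖ C] [IsScalarTower k Aᵐᵒᵖ C]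
  {C' : Type*} [AddCommGroup C'] [Module k C'] [Module A C'] [IsScalarTower k A C']
  {D : Type*} [AddCommGroup D] [Module k D] [Module Bᵐᵒᵖ D] [IsScalarTower k Bᵐᵒᵖ D]
  {D' : Type*} [AddCommGroup D'] [Module k D'] [Module B D'] [IsScalarTower k B D']

namespace BalTensor

variable (A B D D') in
/-- The map `d ⊗ d' ↦ (c ⊗ d) ⊗ (c' ⊗ d')`. -/
def exchangeAux (c : C) (c' : C') :
    BalTensor k B D D' →ₗ[k] BalTensor k (A ⊗[k] B) (C ⊗[k] D) (C' ⊗[k] D') :=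
  lift (LinearMap.mk₂ k (fun d d' => tmul k (A ⊗[k] B) (c ⊗ₜ[k] d) (c' ⊗ₜ[k] d'))
      (fun d₁ d₂ d' => by simp only [TensorProduct.tmul_add, add_tmul])
      (fun r d d' => by simp only [TensorProduct.tmul_smul, smul_tmul'])
      (fun d d₁ d₂ => by simp only [TensorProduct.tmul_add, tmul_add])
      (fun r d d' => by simp only [TensorProduct.tmul_smul, tmul_smul]))
    (by
      intro b d d'
      have := smul_tmul (k := k) (1 ⊗ₜ[k] b : A ⊗[k] B) (c ⊗ₜ[k] d) (c' ⊗ₜ[k] d')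
      simpa using this)

theorem exchangeAux_tmul (c : C) (c' : C') (d : D) (d' : D') :
    exchangeAux A B D D' c c' (tmul k B d d') =
      tmul k (A ⊗[k] B) (c ⊗ₜ[k] d) (c' ⊗ₜ[k] d') := rfl

variable (k A B C C' D D') in
/-- The canonical map
`(C ⊗_A C') ⊗[k] (D ⊗_B D') → (C ⊗[k] D) ⊗_{A ⊗[k] B} (C' ⊗[k] D')`, which sends
`(c ⊗ c') ⊗ (d ⊗ d')` to `(c ⊗ d) ⊗ (c' ⊗ d')`. -/
def exchange : BalTensor k A C C' ⊗[k] BalTensor k B D D' →ₗ[k]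
    BalTensor k (A ⊗[k] B) (C ⊗[k] D) (C' ⊗[k] D') :=
  TensorProduct.lift (lift (LinearMap.mk₂ k (fun c c' => exchangeAux A B D D' c c')
      (fun c₁ c₂ c' => hom_ext fun d d' => by
        simp only [exchangeAux_tmul, LinearMap.add_apply, TensorProduct.add_tmul, add_tmul])
      (fun r c c' => hom_ext fun d d' => by
        simp only [exchangeAux_tmul, LinearMap.smul_apply, ← TensorProduct.smul_tmul', smul_tmul'])
      (fun c c₁ c₂ => hom_ext fun d d' => by
        simp only [exchangeAux_tmul, LinearMap.add_apply, TensorProduct.add_tmul, tmul_add])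
      (fun r c c' => hom_ext fun d d' => by
        simp only [exchangeAux_tmul, LinearMap.smul_apply, ← TensorProduct.smul_tmul', tmul_smul]))
    (by
      intro a c c'
      refine hom_ext fun d d' => ?_
      have := smul_tmul (k := k) (a ⊗ₜ[k] 1 : A ⊗[k] B) (c ⊗ₜ[k] d) (c' ⊗ₜ[k] d')
      simpa [exchangeAux_tmul] using this))

@[simp]
theorem exchange_tmul (c : C) (c' : C') (d : D) (d' : D') :
    exchange k A B C C' D D' (tmul k A c c' ⊗ₜ[k] tmul k B d d') =
      tmul k (A ⊗[k] B) (c ⊗ₜ[k] d) (c' ⊗ₜ[k] d') := rfl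

/-- To check an additive identity on `(C ⊗_A C') ⊗[k] (D ⊗_B D')`, pure tensors suffice. -/
theorem tmul_hom_ext {P : Type*} [AddCommGroup P] [Module k P]
    {f g : BalTensor k A C C' ⊗[k] BalTensor k B D D' →ₗ[k] P}
    (h : ∀ c c' d d', f (tmul k A c c' ⊗ₜ[k] tmul k B d d') =
      g (tmul k A c c' ⊗ₜ[k] tmul k B d d')) : f = g :=
  TensorProduct.ext (hom_ext fun c c' => hom_ext fun d d' => h c c' d d')

end BalTensor

end Exchange

section TensorCoring

variable {k : Type*} [CommRing k] {A : Type*} [Ring A] [Algebra k A]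
  {B : Type*} [Ring B] [Algebra k B]
variable {C : Type*} [AddCommGroup C] [Module k C] [Module A C] [Module Aᵐᵒᵖ C]
  [SMulCommClass A Aᵐᵒᵖ C] [IsScalarTower k A C] [IsScalarTower k Aᵐᵒᵖ C]
variable {D : Type*} [AddCommGroup D] [Module k D] [Module B D] [Module Bᵐᵒᵖ D]
  [SMulCommClass B Bᵐᵒᵖ D] [IsScalarTower k B D] [IsScalarTower k Bᵐᵒᵖ D]

namespace BalTensor

theorem exchange_lsmul {C' : Type*} [AddCommGroup C'] [Module k C'] [Module A C']
    [IsScalarTower k A C'] {D' : Type*} [AddCommGroup D'] [Module k D'] [Module B D']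
    [IsScalarTower k B D'] (t : A ⊗[k] B) (x : BalTensor k A C C' ⊗[k] BalTensor k B D D') :
    exchange k A B C C' D D' (t • x) = t • exchange k A B C C' D D' x := by
  induction t using TensorProduct.induction_on with
  | zero => simp
  | add s t hs ht => simp only [add_smul, map_add, hs, ht]
  | tmul a b =>
    exact LinearMap.congr_fun
      (f := exchange k A B C C' D D' ∘ₗ Algebra.lsmul k k _ (a ⊗ₜ[k] b))
      (g := Algebra.lsmul k k _ (a ⊗ₜ[k] b) ∘ₗ exchange k A B C C' D D')
      (tmul_hom_ext fun c c' d d' => by simp) x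

theorem exchange_rsmul {C₀ : Type*} [AddCommGroup C₀] [Module k C₀] [Module Aᵐᵒᵖ C₀]
    [IsScalarTower k Aᵐᵒᵖ C₀] {D₀ : Type*} [AddCommGroup D₀] [Module k D₀] [Module Bᵐᵒᵖ D₀]
    [IsScalarTower k Bᵐᵒᵖ D₀] (t : A ⊗[k] B) (x : BalTensor k A C₀ C ⊗[k] BalTensor k B D₀ D) :
    exchange k A B C₀ C D₀ D (op t • x) = op t • exchange k A B C₀ C D₀ D x := by
  induction t using TensorProduct.induction_on with
  | zero => simp
  | add s t hs ht => simp only [op_add, add_smul, map_add, hs, ht]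
  | tmul a b =>
    exact LinearMap.congr_fun
      (f := exchange k A B C₀ C D₀ D ∘ₗ Algebra.lsmul k k _ (op (a ⊗ₜ[k] b)))
      (g := Algebra.lsmul k k _ (op (a ⊗ₜ[k] b)) ∘ₗ exchange k A B C₀ C D₀ D)
      (tmul_hom_ext fun c c' d d' => by simp) x

end BalTensor

namespace Coring

open BalTensor

/-- The comultiplication of `C ⊗[k] D`, the composite of `Δ_C ⊗ Δ_D` and the canonical map
`(C ⊗_A C) ⊗[k] (D ⊗_B D) → (C ⊗[k] D) ⊗_{A ⊗[k] B} (C ⊗[k] D)`. -/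
def tensorComul (𝒞 : Coring k A C) (𝒟 : Coring k B D) :
    C ⊗[k] D →ₗ[k] BalTensor k (A ⊗[k] B) (C ⊗[k] D) (C ⊗[k] D) :=
  exchange k A B C C D D ∘ₗ TensorProduct.map 𝒞.comul 𝒟.comul

theorem tensorComul_tmul (𝒞 : Coring k A C) (𝒟 : Coring k B D) (c : C) (d : D) :
    tensorComul 𝒞 𝒟 (c ⊗ₜ[k] d) = exchange k A B C C D D (𝒞.comul c ⊗ₜ[k] 𝒟.comul d) := rfl

theorem tensorComul_lsmul (𝒞 : Coring k A C) (𝒟 : Coring k B D) (t : A ⊗[k] B)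
    (x : C ⊗[k] D) : tensorComul 𝒞 𝒟 (t • x) = t • tensorComul 𝒞 𝒟 x := by
  induction t using TensorProduct.induction_on with
  | zero => simp
  | add s t hs ht => simp only [add_smul, map_add, hs, ht]
  | tmul a b =>
    induction x using TensorProduct.induction_on with
    | zero => simp
    | add s t hs ht => simp only [smul_add, map_add, hs, ht]
    | tmul c d =>
      rw [tensor_lsmul_tmul, tensorComul_tmul, tensorComul_tmul, comul_lsmul, comul_lsmul,
        ← exchange_lsmul, tensor_lsmul_tmul]

theorem tensorComul_rsmul (𝒞 : Coring k A C) (𝒟 : Coring k B D) (t : A ⊗[k] B)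
    (x : C ⊗[k] D) : tensorComul 𝒞 𝒟 (op t • x) = op t • tensorComul 𝒞 𝒟 x := by
  induction t using TensorProduct.induction_on with
  | zero => simp
  | add s t hs ht => simp only [op_add, add_smul, map_add, hs, ht]
  | tmul a b =>
    induction x using TensorProduct.induction_on with
    | zero => simp
    | add s t hs ht => simp only [smul_add, map_add, hs, ht]
    | tmul c d =>
      rw [tensor_rsmul_tmul, tensorComul_tmul, tensorComul_tmul, comul_rsmul, comul_rsmul,
        ← exchange_rsmul, tensor_rsmul_tmul]

/-- The counit `ε_C ⊗ ε_D` of `C ⊗[k] D`. -/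
def tensorCounit (𝒞 : Coring k A C) (𝒟 : Coring k B D) : C ⊗[k] D →ₗ[k] A ⊗[k] B :=
  TensorProduct.map 𝒞.counit 𝒟.counit

theorem tensorCounit_tmul (𝒞 : Coring k A C) (𝒟 : Coring k B D) (c : C) (d : D) :
    tensorCounit 𝒞 𝒟 (c ⊗ₜ[k] d) = 𝒞.counit c ⊗ₜ[k] 𝒟.counit d := rfl

theorem tensorCounit_lsmul (𝒞 : Coring k A C) (𝒟 : Coring k B D) (t : A ⊗[k] B)
    (x : C ⊗[k] D) : tensorCounit 𝒞 𝒟 (t • x) = t • tensorCounit 𝒞 𝒟 x := by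
  induction t using TensorProduct.induction_on with
  | zero => simp
  | add s t hs ht => simp only [add_smul, map_add, hs, ht]
  | tmul a b =>
    induction x using TensorProduct.induction_on with
    | zero => simp
    | add s t hs ht => simp only [smul_add, map_add, hs, ht]
    | tmul c d =>
      simp [tensorCounit_tmul, counit_lsmul]

theorem tensorCounit_rsmul (𝒞 : Coring k A C) (𝒟 : Coring k B D) (t : A ⊗[k] B)
    (x : C ⊗[k] D) : tensorCounit 𝒞 𝒟 (op t • x) = op t • tensorCounit 𝒞 𝒟 x := by
  induction t using TensorProduct.induction_on with
  | zero => simp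
  | add s t hs ht => simp only [op_add, add_smul, map_add, hs, ht]
  | tmul a b =>
    induction x using TensorProduct.induction_on with
    | zero => simp
    | add s t hs ht => simp only [smul_add, map_add, hs, ht]
    | tmul c d =>
      simp [tensorCounit_tmul, counit_rsmul]

/-- The tensor product `C ⊗[k] D` of an `A`-coring `C` and a `B`-coring `D`, as an
`A ⊗[k] B`-coring. -/
def tensor (𝒞 : Coring k A C) (𝒟 : Coring k B D) : Coring k (A ⊗[k] B) (C ⊗[k] D) where
  comul := tensorComul 𝒞 𝒟
  comul_lsmul := tensorComul_lsmul 𝒞 𝒟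
  comul_rsmul := tensorComul_rsmul 𝒞 𝒟
  counit := tensorCounit 𝒞 𝒟
  counit_lsmul := tensorCounit_lsmul 𝒞 𝒟
  counit_rsmul := tensorCounit_rsmul 𝒞 𝒟
  coassoc x := by
    have h₁ : map LinearMap.id (tensorComul 𝒞 𝒟) id_rsmul (tensorComul_lsmul 𝒞 𝒟) ∘ₗ
          exchange k A B C C D D =
        map LinearMap.id (exchange k A B C C D D) id_rsmul exchange_lsmul ∘ₗ
          exchange k A B C (BalTensor k A C C) D (BalTensor k B D D) ∘ₗ
            TensorProduct.map (map LinearMap.id 𝒞.comul id_rsmul 𝒞.comul_lsmul)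
              (map LinearMap.id 𝒟.comul id_rsmul 𝒟.comul_lsmul) :=
      tmul_hom_ext fun c c' d d' => by simp [tensorComul_tmul]
    have h₂ : map (tensorComul 𝒞 𝒟) LinearMap.id (tensorComul_rsmul 𝒞 𝒟) id_lsmul ∘ₗ
          exchange k A B C C D D =
        map (exchange k A B C C D D) LinearMap.id exchange_rsmul id_lsmul ∘ₗ
          exchange k A B (BalTensor k A C C) C (BalTensor k B D D) D ∘ₗ
            TensorProduct.map (map 𝒞.comul LinearMap.id 𝒞.comul_rsmul id_lsmul)
              (map 𝒟.comul LinearMap.id 𝒟.comul_rsmul id_lsmul) :=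
      tmul_hom_ext fun c c' d d' => by simp [tensorComul_tmul]
    have h₃ : (assoc k (A ⊗[k] B) (C ⊗[k] D) (C ⊗[k] D) (C ⊗[k] D)).toLinearMap ∘ₗ
          map (exchange k A B C C D D) LinearMap.id exchange_rsmul id_lsmul ∘ₗ
            exchange k A B (BalTensor k A C C) C (BalTensor k B D D) D =
        map LinearMap.id (exchange k A B C C D D) id_rsmul exchange_lsmul ∘ₗ
          exchange k A B C (BalTensor k A C C) D (BalTensor k B D D) ∘ₗ
            TensorProduct.map (assoc k A C C C).toLinearMap (assoc k B D D D).toLinearMap := by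
      refine tmul_hom_ext fun x c y d => ?_
      induction x using BalTensor.induction_on with
      | zero => simp
      | add x x' hx hx' => simp only [add_tmul, TensorProduct.add_tmul, map_add, hx, hx']
      | tmul c₁ c₂ =>
        induction y using BalTensor.induction_on with
        | zero => simp
        | add y y' hy hy' => simp only [add_tmul, TensorProduct.tmul_add, map_add, hy, hy']
        | tmul d₁ d₂ => simp
    induction x using TensorProduct.induction_on with
    | zero => simp
    | add x y hx hy => simp only [map_add, hx, hy]
    | tmul c d =>
      have e₁ := LinearMap.congr_fun h₁ (𝒞.comul c ⊗ₜ[k] 𝒟.comul d)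
      have e₂ := LinearMap.congr_fun h₂ (𝒞.comul c ⊗ₜ[k] 𝒟.comul d)
      simp only [LinearMap.comp_apply, TensorProduct.map_tmul] at e₁ e₂
      rw [tensorComul_tmul, e₁, e₂, 𝒞.coassoc, 𝒟.coassoc]
      have e₃ := LinearMap.congr_fun h₃
        (map 𝒞.comul LinearMap.id 𝒞.comul_rsmul id_lsmul (𝒞.comul c) ⊗ₜ[k]
          map 𝒟.comul LinearMap.id 𝒟.comul_rsmul id_lsmul (𝒟.comul d))
      simp only [LinearMap.comp_apply, TensorProduct.map_tmul, LinearEquiv.coe_coe] at e₃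
      exact e₃.symm
  rid_comul x := by
    have h : rid k (A ⊗[k] B) (C ⊗[k] D) ∘ₗ
          map LinearMap.id (tensorCounit 𝒞 𝒟) id_rsmul (tensorCounit_lsmul 𝒞 𝒟) ∘ₗ
            exchange k A B C C D D =
        TensorProduct.map
          (rid k A C ∘ₗ map LinearMap.id 𝒞.counit id_rsmul 𝒞.counit_lsmul)
          (rid k B D ∘ₗ map LinearMap.id 𝒟.counit id_rsmul 𝒟.counit_lsmul) :=
      tmul_hom_ext fun c c' d d' => by simp [tensorCounit_tmul]
    induction x using TensorProduct.induction_on with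
    | zero => simp
    | add x y hx hy => simp only [map_add, hx, hy]
    | tmul c d =>
      have e := LinearMap.congr_fun h (𝒞.comul c ⊗ₜ[k] 𝒟.comul d)
      simp only [LinearMap.comp_apply, TensorProduct.map_tmul, rid_comul] at e
      exact e
  lid_comul x := by
    have h : lid k (A ⊗[k] B) (C ⊗[k] D) ∘ₗ
          map (tensorCounit 𝒞 𝒟) LinearMap.id (tensorCounit_rsmul 𝒞 𝒟) id_lsmul ∘ₗ
            exchange k A B C C D D =
        TensorProduct.map
          (lid k A C ∘ₗ map 𝒞.counit LinearMap.id 𝒞.counit_rsmul id_lsmul)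
          (lid k B D ∘ₗ map 𝒟.counit LinearMap.id 𝒟.counit_rsmul id_lsmul) :=
      tmul_hom_ext fun c c' d d' => by simp [tensorCounit_tmul]
    induction x using TensorProduct.induction_on with
    | zero => simp
    | add x y hx hy => simp only [map_add, hx, hy]
    | tmul c d =>
      have e := LinearMap.congr_fun h (𝒞.comul c ⊗ₜ[k] 𝒟.comul d)
      simp only [LinearMap.comp_apply, TensorProduct.map_tmul, lid_comul] at e
      exact e

end Coring

end TensorCoring

end

/-! The idea is to average a projection twice. Since all of `C ⊗ D` carries a right `B`-action and a
`D`-coaction through its second factor, it is a `D`-comodule; the maps `d ↦ c ⊗ d` are colinear, so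
the images of the simple subcomodules of `D` are zero or simple and generate `C ⊗ D`. Hence every
sub-`D`-comodule of `C ⊗ D` has a complement (`IsSemisimpleFamily.exists_isCompl`).

On the other hand, applying one counit at a time to the coaction of `C ⊗ D` recovers the two
separate coactions, so a subcomodule over the tensor coring is the same as a submodule stable under
both actions and both coactions (`Coring.isSubcomodule_tensor_iff`). Let `N` be one. A projection
`p` onto `N` along a complementary sub-`D`-comodule is `B`-linear and `D`-colinear. With a
separability idempotent `∑ x ⊗ y` of `A`, the map `m ↦ ∑ p (m x) y` is moreover `A`-linear. With the
cointegral `γ = ε π` of the coseparable coring `C`, the map `m ↦ f (m₀)₀ γ (f (m₀)₁ ⊗ m₁)` made from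
this `A`-linear map `f` is moreover `C`-colinear. Both averages act only through the first factor,
so `D`-colinearity survives; both still map into `N` and fix it. The image of the identity minus the
result is a complementary subcomodule (`Coring.exists_isCompl_of_second`).

Passing from complements to a direct sum of simples requires enough compact elements in the lattice
of subcomodules, hence closure under arbitrary intersections. Flatness only handles finite ones. For
the `D`-coaction, an intersection of subcomodules is, inside a finite sum of simples, a finite
intersection (`exists_finset_inf_le`). For the `C`-coaction, separability makes `M ⊗_A C` a natural
direct summand of `M ⊗_k C`, where the splitting of sub-`D`-comodules over `k` settles the question
(`IsSeparableAlgebra.mem_tensorSpan_sInf`). The lattice is then modular, compactly generated and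
complemented, so its top is a sum of an independent set of atoms.

Flatness of `C ⊗ D` is separate: tensoring with it over `A ⊗ B` amounts to tensoring with `C` over
`A`, then with `D` over `B` (`isLeftFlat_tensor`). -/

noncomputable section

/-! ## Families of submodules closed under sums and intersections -/

section Lattice

/-- A complete sublattice of a lattice of submodules is compactly generated. -/
theorem CompleteSublattice.isCompactlyGenerated_submodule {R M : Type*} [Ring R] [AddCommGroup M]
    [Module R M] (L : CompleteSublattice (Submodule R M)) : IsCompactlyGenerated L := by
  -- The least member containing `x`; it exists because `L` is closed under arbitrary intersections.
  let c : M → L := fun x => sInf {N : L | x ∈ (N : Submodule R M)}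
  have hc : ∀ (x : M) (N : L), x ∈ (N : Submodule R M) ↔ c x ≤ N := by
    intro x N
    refine ⟨fun h => sInf_le h, fun h => h ?_⟩
    rw [CompleteSublattice.coe_sInf', Submodule.mem_iInf]
    intro K
    rw [Submodule.mem_iInf]
    exact fun hK => hK
  refine ⟨fun N => ⟨c '' {x | x ∈ (N : Submodule R M)}, ?_, ?_⟩⟩
  · rintro _ ⟨x, -, rfl⟩
    -- `c x` is compact since it lies below `N` exactly when `x ∈ N`, and an element of a directed
    -- union lies in one of its members.
    rw [CompleteLattice.isCompactElement_iff_le_of_directed_sSup_le]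
    intro s hs hdir hle
    rw [← hc, CompleteSublattice.coe_sSup] at hle
    have hdir' : DirectedOn (· ≤ ·) {N : Submodule R M | ∃ K ∈ s, (K : Submodule R M) = N} := by
      rintro _ ⟨N₁, h₁, rfl⟩ _ ⟨N₂, h₂, rfl⟩
      obtain ⟨N₃, h₃, h₁₃, h₂₃⟩ := hdir N₁ h₁ N₂ h₂
      exact ⟨N₃, ⟨N₃, h₃, rfl⟩, h₁₃, h₂₃⟩
    have hne : {N : Submodule R M | ∃ K ∈ s, (K : Submodule R M) = N}.Nonempty := by
      obtain ⟨K, hK⟩ := hs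
      exact ⟨_, K, hK, rfl⟩
    obtain ⟨_, ⟨K, hK, rfl⟩, hx⟩ := (Submodule.mem_sSup_of_directed hne hdir').1 hle
    exact ⟨K, hK, (hc x K).1 hx⟩
  · refine le_antisymm (sSup_le ?_) ?_
    · rintro _ ⟨x, hx, rfl⟩
      exact (hc x N).1 hx
    · intro x hx
      have hle : c x ≤ sSup (c '' {x | x ∈ (N : Submodule R M)}) :=
        le_sSup (Set.mem_image_of_mem c hx)
      exact hle ((hc x (c x)).2 le_rfl)

instance CompleteSublattice.isModularLattice_submodule {R M : Type*} [Ring R] [AddCommGroup M]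
    [Module R M] (L : CompleteSublattice (Submodule R M)) : IsModularLattice L :=
  ⟨fun {x} y {z} h => IsModularLattice.sup_inf_le_assoc_of_le (x := (x : Submodule R M))
    (y : Submodule R M) (z := (z : Submodule R M)) h⟩

/-! ### Semisimple families: intersections, complements and projections -/

/-- `N` is a minimal nonzero member of `𝓛`. -/
def IsSimpleIn {α : Type*} [CompleteLattice α] (𝓛 : Set α) (N : α) : Prop :=
  N ∈ 𝓛 ∧ N ≠ ⊥ ∧ ∀ L ≤ N, L ∈ 𝓛 → L = ⊥ ∨ L = N

/-- A family of submodules which is closed under sums and finite intersections, and whose simple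
members generate the whole module. -/
structure IsSemisimpleFamily {R M : Type*} [Ring R] [AddCommGroup M] [Module R M]
    (𝓛 : Set (Submodule R M)) : Prop where
  sSup_mem : ∀ 𝓕 ⊆ 𝓛, sSup 𝓕 ∈ 𝓛
  inf_mem : ∀ N ∈ 𝓛, ∀ N' ∈ 𝓛, N ⊓ N' ∈ 𝓛
  sSup_simple : sSup {N | IsSimpleIn 𝓛 N} = ⊤

namespace IsSemisimpleFamily

variable {R M : Type*} [Ring R] [AddCommGroup M] [Module R M] {𝓛 : Set (Submodule R M)}
  (h : IsSemisimpleFamily 𝓛)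

include h

theorem sup_mem {N N' : Submodule R M} (hN : N ∈ 𝓛) (hN' : N' ∈ 𝓛) : N ⊔ N' ∈ 𝓛 := by
  rw [← sSup_pair]
  exact h.sSup_mem _ (by rintro _ (rfl | rfl) <;> assumption)

theorem top_mem : ⊤ ∈ 𝓛 := by
  rw [← h.sSup_simple]
  exact h.sSup_mem _ fun N hN => hN.1

theorem sInf_finset_mem (s : Finset (Submodule R M)) (hs : (s : Set (Submodule R M)) ⊆ 𝓛) :
    sInf (s : Set (Submodule R M)) ∈ 𝓛 := by
  classical
  induction s using Finset.induction_on with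
  | empty => simpa using h.top_mem
  | insert N s _ ih =>
    rw [Finset.coe_insert, Set.insert_subset_iff] at hs
    rw [Finset.coe_insert, sInf_insert]
    exact h.inf_mem _ hs.1 _ (ih hs.2)

theorem sSup_finset_mem (s : Finset (Submodule R M)) (hs : ∀ N ∈ s, IsSimpleIn 𝓛 N) :
    sSup (s : Set (Submodule R M)) ∈ 𝓛 :=
  h.sSup_mem _ fun N hN => (hs N hN).1

/-- By the modular law `X = S ⊔ (T ⊓ X)`, and `T ⊓ X` is a member below the simple `T`. So adding
one simple member lengthens a chain by at most one step. -/
theorem eq_or_eq_of_le_sup {S T X : Submodule R M} (hT : IsSimpleIn 𝓛 T) (hX : X ∈ 𝓛)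
    (h₁ : S ≤ X) (h₂ : X ≤ S ⊔ T) : X = S ∨ X = S ⊔ T := by
  have hX' : X = S ⊔ T ⊓ X := by
    rw [← sup_inf_assoc_of_le T h₁]
    exact (inf_eq_right.2 h₂).symm
  rcases hT.2.2 (T ⊓ X) inf_le_left (h.inf_mem _ hT.1 _ hX) with h0 | h0
  · left; rw [hX', h0, sup_bot_eq]
  · right; rw [h0] at hX'; exact hX'

/-- Inside a finite sum of simple members, an intersection is a finite intersection. -/
theorem exists_finset_inf_le (s : Finset (Submodule R M)) (hs : ∀ N ∈ s, IsSimpleIn 𝓛 N)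
    {𝓕 : Set (Submodule R M)} (h𝓕 : 𝓕 ⊆ 𝓛) :
    ∃ t : Finset (Submodule R M), (t : Set (Submodule R M)) ⊆ 𝓕 ∧
      sSup (s : Set (Submodule R M)) ⊓ sInf (t : Set (Submodule R M)) ≤ sInf 𝓕 := by
  classical
  induction s using Finset.induction_on with
  | empty => exact ⟨∅, by simp, by simp⟩
  | insert T s _ ih =>
    have hT := hs T (Finset.mem_insert_self _ _)
    have hs' : ∀ N ∈ s, IsSimpleIn 𝓛 N := fun N hN => hs N (Finset.mem_insert_of_mem hN)
    obtain ⟨t, ht, hle⟩ := ih hs'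
    -- If the set `t` found for `s` fails after `T` is added, a single further member `N` of `𝓕`
    -- repairs it: `N` must cut off the whole of the extra simple layer.
    by_cases hall : sSup ((insert T s : Finset (Submodule R M)) : Set (Submodule R M)) ⊓
        sInf (t : Set (Submodule R M)) ≤ sInf 𝓕
    · exact ⟨t, ht, hall⟩
    rw [le_sInf_iff] at hall
    push Not at hall
    obtain ⟨N, hN, hnle⟩ := hall
    have ht' : ((insert N t : Finset (Submodule R M)) : Set (Submodule R M)) ⊆ 𝓕 := by
      rw [Finset.coe_insert, Set.insert_subset_iff]
      exact ⟨hN, ht⟩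
    refine ⟨insert N t, ht', ?_⟩
    rw [Finset.coe_insert, sSup_insert] at hnle ⊢
    have hI₁ := h.sInf_finset_mem _ (ht'.trans h𝓕)
    rw [Finset.coe_insert, sInf_insert] at hI₁ ⊢
    have hS := h.sSup_finset_mem s hs'
    set S := sSup (s : Set (Submodule R M)) with hSdef
    set I₀ := sInf (t : Set (Submodule R M)) with hI₀def
    have hSN : S ⊓ I₀ ≤ N := hle.trans (sInf_le hN)
    have hW₁ : (T ⊔ S) ⊓ (N ⊓ I₀) ∈ 𝓛 := h.inf_mem _ (h.sup_mem hT.1 hS) _ hI₁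
    -- With `W = (T ⊔ S) ⊓ (N ⊓ I₀)`, the sum `S ⊔ W` lies between `S` and `S ⊔ T`. In the first
    -- case `W ≤ S` and the induction hypothesis applies; the second contradicts the choice of `N`.
    rcases h.eq_or_eq_of_le_sup (S := S) hT (h.sup_mem hS hW₁) le_sup_left
      (sup_le le_sup_left (inf_le_left.trans (sup_comm T S).le)) with h0 | h0
    · have : (T ⊔ S) ⊓ (N ⊓ I₀) ≤ S := le_sup_right.trans h0.le
      exact (le_inf this (inf_le_right.trans inf_le_right)).trans hle
    · exfalso
      refine hnle ?_
      -- Modular cancellation: `W` and `(T ⊔ S) ⊓ I₀` are comparable, have the same meet with `S`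
      -- because `S ⊓ I₀ ≤ N`, and the same join with `S`. So they agree, which forces `(T ⊔ S) ⊓ I₀
      -- ≤ N`.
      have hmod : (T ⊔ S) ⊓ I₀ ≤ (T ⊔ S) ⊓ (N ⊓ I₀) := by
        refine le_of_eq (eq_of_le_of_inf_le_of_sup_le (z := S) ?_ ?_ ?_).symm
        · exact inf_le_inf_left _ inf_le_right
        · refine le_inf (le_inf (inf_le_left.trans inf_le_left) (le_inf ?_ ?_)) inf_le_right
          · exact (le_inf inf_le_right (inf_le_left.trans inf_le_right)).trans hSN
          · exact inf_le_left.trans inf_le_right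
        · rw [sup_comm ((T ⊔ S) ⊓ I₀) S, sup_comm ((T ⊔ S) ⊓ (N ⊓ I₀)) S, h0]
          exact sup_le le_sup_left (inf_le_left.trans (sup_comm T S).le)
      exact hmod.trans (inf_le_right.trans inf_le_left)

/-- Every element lies in a finite sum of simple members. -/
theorem exists_finset_mem (x : M) : ∃ s : Finset (Submodule R M), (∀ N ∈ s, IsSimpleIn 𝓛 N) ∧
    x ∈ sSup (s : Set (Submodule R M)) := by
  classical
  have hx : x ∈ sSup {N | IsSimpleIn 𝓛 N} := h.sSup_simple ▸ Submodule.mem_top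
  rw [sSup_eq_iSup'] at hx
  induction hx using Submodule.iSup_induction' with
  | mem N y hy => exact ⟨{N.1}, fun K hK => (Finset.mem_singleton.1 hK) ▸ N.2, by simpa using hy⟩
  | zero => exact ⟨∅, by simp, zero_mem _⟩
  | add y z _ _ hy hz =>
    obtain ⟨s, hs, hys⟩ := hy
    obtain ⟨t, ht, hzt⟩ := hz
    refine ⟨s ∪ t, fun N hN => (Finset.mem_union.1 hN).elim (hs N) (ht N), ?_⟩
    rw [Finset.coe_union, sSup_union]
    exact Submodule.add_mem_sup hys hzt

/-- An intersection is the sum of the members it contains: each of its elements lies in a finite sum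
of simple members, and there a finite intersection, which is a member, already falls inside `sInf
𝓕`. -/
theorem sInf_mem {𝓕 : Set (Submodule R M)} (h𝓕 : 𝓕 ⊆ 𝓛) : sInf 𝓕 ∈ 𝓛 := by
  have : sInf 𝓕 = sSup {N | N ∈ 𝓛 ∧ N ≤ sInf 𝓕} := by
    refine le_antisymm (fun x hx => ?_) (sSup_le fun N hN => hN.2)
    obtain ⟨s, hs, hxs⟩ := h.exists_finset_mem x
    obtain ⟨t, ht, hle⟩ := h.exists_finset_inf_le s hs h𝓕
    have hmem : sSup (s : Set (Submodule R M)) ⊓ sInf (t : Set (Submodule R M)) ∈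
        {N | N ∈ 𝓛 ∧ N ≤ sInf 𝓕} :=
      ⟨h.inf_mem _ (h.sSup_finset_mem s hs) _ (h.sInf_finset_mem t (ht.trans h𝓕)), hle⟩
    exact le_sSup hmem (Submodule.mem_inf.2 ⟨hxs, sInf_le_sInf ht hx⟩)
  rw [this]
  exact h.sSup_mem _ fun N hN => hN.1

/-- The complete lattice of members of the family. -/
def toCompleteSublattice : CompleteSublattice (Submodule R M) :=
  CompleteSublattice.mk' 𝓛 (fun 𝓕 h𝓕 => h.sSup_mem 𝓕 h𝓕) (fun _ h𝓕 => h.sInf_mem h𝓕)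

/-- The members form a compactly generated modular lattice whose atoms are the simple members. Since
these join to the top, the lattice is complemented. -/
theorem exists_isCompl {N : Submodule R M} (hN : N ∈ 𝓛) : ∃ N' ∈ 𝓛, IsCompl N N' := by
  let L := h.toCompleteSublattice
  have : IsCompactlyGenerated L := L.isCompactlyGenerated_submodule
  have htop : sSup {a : L | IsAtom a} = ⊤ := by
    refine Subtype.ext ?_
    rw [CompleteSublattice.coe_sSup, CompleteSublattice.coe_top, eq_top_iff, ← h.sSup_simple]
    refine sSup_le_sSup fun T hT => ⟨⟨T, hT.1⟩, ⟨fun h0 => hT.2.1 (congrArg Subtype.val h0), ?_⟩, rfl⟩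
    intro K hK
    refine Subtype.ext ((hT.2.2 K.1 hK.le K.2).resolve_right fun h0 => hK.ne (Subtype.ext h0))
  have := complementedLattice_of_sSup_atoms_eq_top htop
  obtain ⟨N', hN'⟩ := ComplementedLattice.exists_isCompl (⟨N, hN⟩ : L)
  refine ⟨N'.1, N'.2, ?_, ?_⟩
  · rw [disjoint_iff]
    exact congrArg Subtype.val (disjoint_iff.1 hN'.1)
  · rw [codisjoint_iff]
    exact congrArg Subtype.val (codisjoint_iff.1 hN'.2)

/-- Given two members, there is a projection onto the first which maps the second to the
intersection. -/
theorem exists_projection {N N' : Submodule R M} (hN : N ∈ 𝓛) (hN' : N' ∈ 𝓛) :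
    ∃ p : M →ₗ[R] M, (∀ n ∈ N, p n = n) ∧ ∀ n ∈ N', p n ∈ N ⊓ N' := by
  -- `K₀ ⊓ N'` complements `N ⊓ N'` inside `N'` and is disjoint from `N`. Any complement of `N` that
  -- contains it gives a projection killing this part of `N'`; `Q₀` extends it to such a complement.
  obtain ⟨K₀, hK₀, hc⟩ := h.exists_isCompl (h.inf_mem _ hN _ hN')
  have hsup : N ⊓ N' ⊔ K₀ ⊓ N' = N' := by
    rw [← sup_inf_assoc_of_le K₀ inf_le_right, hc.sup_eq_top, top_inf_eq]
  have hdisj : Disjoint N (K₀ ⊓ N') := by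
    rw [disjoint_iff, inf_comm K₀, ← inf_assoc]
    exact hc.inf_eq_bot
  obtain ⟨Q₀, -, hQ⟩ := h.exists_isCompl (h.sup_mem hN (h.inf_mem _ hK₀ _ hN'))
  have hcompl : IsCompl N (K₀ ⊓ N' ⊔ Q₀) :=
    ⟨hdisj.disjoint_sup_right_of_disjoint_sup_left hQ.1, by
      rw [codisjoint_iff, ← sup_assoc]; exact hQ.sup_eq_top⟩
  refine ⟨N.subtype ∘ₗ N.projectionOnto _ hcompl, fun n hn => ?_, fun n hn => ?_⟩
  · exact congrArg Subtype.val (Submodule.projectionOnto_apply_left hcompl ⟨n, hn⟩)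
  · rw [← hsup] at hn
    obtain ⟨a, ha, b, hb, rfl⟩ := Submodule.mem_sup.1 hn
    have e₁ := congrArg Subtype.val (Submodule.projectionOnto_apply_left hcompl ⟨a, ha.1⟩)
    have e₂ := Submodule.projectionOnto_apply_right hcompl
      ⟨b, (le_sup_left : _ ≤ K₀ ⊓ N' ⊔ Q₀) hb⟩
    simp only [LinearMap.comp_apply, map_add] at e₁ e₂ ⊢
    rw [e₂, map_zero, add_zero]
    change ((N.projectionOnto _ hcompl a : N) : M) ∈ _
    rw [e₁]
    exact ha

end IsSemisimpleFamily

/-! ### Intersections in tensor products over the base ring -/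

section Tensor

variable {k M : Type*} [CommRing k] [AddCommGroup M] [Module k M] (C : Type*) [AddCommGroup C]
  [Module k C]

/-- The submodule of `M ⊗ C` spanned by the pure tensors `n ⊗ c` with `n ∈ N`. -/
def tensorRange (N : Submodule k M) : Submodule k (M ⊗[k] C) :=
  Submodule.span k {x | ∃ n ∈ N, ∃ c : C, n ⊗ₜ[k] c = x}

variable {C}

theorem tmul_mem_tensorRange {N : Submodule k M} {n : M} (hn : n ∈ N) (c : C) :
    n ⊗ₜ[k] c ∈ tensorRange C N :=
  Submodule.subset_span ⟨n, hn, c, rfl⟩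

theorem tensorRange_map_mem {P : Type*} [AddCommGroup P] [Module k P] {N : Submodule k M}
    (φ : M ⊗[k] C →ₗ[k] P) {Q : Submodule k P} (h : ∀ n ∈ N, ∀ c : C, φ (n ⊗ₜ[k] c) ∈ Q)
    {x : M ⊗[k] C} (hx : x ∈ tensorRange C N) : φ x ∈ Q := by
  have : tensorRange C N ≤ Q.comap φ := Submodule.span_le.2 (by
    rintro _ ⟨n, hn, c, rfl⟩
    exact h n hn c)
  exact this hx

theorem tensorRange_mono {N N' : Submodule k M} (h : N ≤ N') :
    tensorRange C N ≤ tensorRange C N' :=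
  fun _ hx => tensorRange_map_mem LinearMap.id (fun _ hn c => tmul_mem_tensorRange (h hn) c) hx

variable {𝓛 : Set (Submodule k M)}

/-- Take the projection `p` onto `N` that sends `N'` into `N ⊓ N'`. Then `p ⊗ C` fixes `x`, as `x`
comes from `N`, and moves it into the part coming from `N ⊓ N'`, as `x` comes from `N'`. The
splitting replaces flatness of `C` over `k`. -/
theorem IsSemisimpleFamily.mem_tensorRange_inf (h : IsSemisimpleFamily 𝓛) {N N' : Submodule k M}
    (hN : N ∈ 𝓛) (hN' : N' ∈ 𝓛) {x : M ⊗[k] C} (hx : x ∈ tensorRange C N)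
    (hx' : x ∈ tensorRange C N') : x ∈ tensorRange C (N ⊓ N') := by
  obtain ⟨p, hp, hp'⟩ := h.exists_projection hN hN'
  have e : LinearMap.rTensor C p x - x = 0 :=
    (Submodule.mem_bot k).1 (tensorRange_map_mem (LinearMap.rTensor C p - LinearMap.id)
      (Q := ⊥) (fun n hn c => by simp [hp n hn]) hx)
  rw [← sub_eq_zero.1 e]
  refine tensorRange_map_mem _ (fun n hn c => ?_) hx'
  rw [LinearMap.rTensor_tmul]
  exact tmul_mem_tensorRange (hp' n hn) c

/-- A single tensor involves finitely many elements, so it comes from a finite sum of simple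
members. There `sInf 𝓕` contains a finite intersection, and the two-member case is iterated. -/
theorem IsSemisimpleFamily.mem_tensorRange_sInf (h : IsSemisimpleFamily 𝓛)
    {𝓕 : Set (Submodule k M)} (h𝓕 : 𝓕 ⊆ 𝓛) {x : M ⊗[k] C}
    (hx : ∀ N ∈ 𝓕, x ∈ tensorRange C N) : x ∈ tensorRange C (sInf 𝓕) := by
  classical
  obtain ⟨s, hs, hxs⟩ : ∃ s : Finset (Submodule k M), (∀ N ∈ s, IsSimpleIn 𝓛 N) ∧
      x ∈ tensorRange C (sSup (s : Set (Submodule k M))) := by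
    clear hx
    induction x using TensorProduct.induction_on with
    | zero => exact ⟨∅, by simp, zero_mem _⟩
    | tmul m c =>
      obtain ⟨s, hs, hm⟩ := h.exists_finset_mem m
      exact ⟨s, hs, tmul_mem_tensorRange hm c⟩
    | add x y hx hy =>
      obtain ⟨s, hs, hxs⟩ := hx
      obtain ⟨t, ht, hyt⟩ := hy
      refine ⟨s ∪ t, fun N hN => (Finset.mem_union.1 hN).elim (hs N) (ht N), ?_⟩
      rw [Finset.coe_union, sSup_union]
      exact add_mem (tensorRange_mono le_sup_left hxs) (tensorRange_mono le_sup_right hyt)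
  obtain ⟨t, ht, hle⟩ := h.exists_finset_inf_le s hs h𝓕
  refine tensorRange_mono hle ?_
  clear hle
  induction t using Finset.induction_on with
  | empty => simpa using hxs
  | insert N t _ ih =>
    rw [Finset.coe_insert, Set.insert_subset_iff] at ht
    have hS := h.sSup_finset_mem s hs
    have hI := h.sInf_finset_mem t (ht.2.trans h𝓕)
    rw [Finset.coe_insert, sInf_insert, inf_left_comm]
    exact h.mem_tensorRange_inf (h𝓕 ht.1) (h.inf_mem _ hS _ hI) (hx N ht.1) (ih ht.2)

end Tensor

end Lattice

/-! ## Submodules of balanced tensor products spanned by pure tensors -/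

/-- A `k`-submodule which is stable under the right action of `A`. -/
def RStable (A : Type*) [Ring A] {k M : Type*} [CommRing k] [AddCommGroup M] [Module k M]
    [Module Aᵐᵒᵖ M] (N : Submodule k M) : Prop :=
  ∀ (a : A), ∀ n ∈ N, op a • n ∈ N

/-- A stable `k`-submodule as a right `A`-submodule. -/
def RStable.toSubmodule {A : Type*} [Ring A] {k M : Type*} [CommRing k] [AddCommGroup M]
    [Module k M] [Module Aᵐᵒᵖ M] {N : Submodule k M} (h : RStable A N) : Submodule Aᵐᵒᵖ M :=
  { N with smul_mem' := fun a n hn => h (unop a) n hn }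

namespace BalTensor

section TensorSpan

variable {k : Type*} [CommRing k] (A : Type*) [Ring A]
variable {M : Type*} [AddCommGroup M] [Module k M] [Module Aᵐᵒᵖ M]
variable {M' : Type*} [AddCommGroup M'] [Module k M'] [Module Aᵐᵒᵖ M']
variable (U : Type*) [AddCommGroup U] [Module k U] [Module A U]

/-- The submodule of `M ⊗_A U` spanned by the pure tensors `n ⊗ u` with `n ∈ N`. -/
def tensorSpan (N : Submodule k M) : Submodule k (BalTensor k A M U) :=
  Submodule.span k {x | ∃ n ∈ N, ∃ u : U, tmul k A n u = x}

variable {A U}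

theorem tmul_mem_tensorSpan {N : Submodule k M} {n : M} (hn : n ∈ N) (u : U) :
    tmul k A n u ∈ tensorSpan A U N :=
  Submodule.subset_span ⟨n, hn, u, rfl⟩

theorem tensorSpan_le {N : Submodule k M} {Q : Submodule k (BalTensor k A M U)} :
    tensorSpan A U N ≤ Q ↔ ∀ n ∈ N, ∀ u : U, tmul k A n u ∈ Q := by
  refine ⟨fun h n hn u => h (tmul_mem_tensorSpan hn u), fun h => Submodule.span_le.2 ?_⟩
  rintro _ ⟨n, hn, u, rfl⟩
  exact h n hn u

theorem tensorSpan_mono {N N' : Submodule k M} (h : N ≤ N') :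
    tensorSpan A U N ≤ tensorSpan A U N' :=
  tensorSpan_le.2 fun _ hn u => tmul_mem_tensorSpan (h hn) u

theorem tensorSpan_map_mem {P : Type*} [AddCommGroup P] [Module k P] {N : Submodule k M}
    (φ : BalTensor k A M U →ₗ[k] P) {Q : Submodule k P}
    (h : ∀ n ∈ N, ∀ u : U, φ (tmul k A n u) ∈ Q) {x : BalTensor k A M U}
    (hx : x ∈ tensorSpan A U N) : φ x ∈ Q :=
  (tensorSpan_le (Q := Q.comap φ)).2 h hx

theorem eqOn_tensorSpan {P : Type*} [AddCommGroup P] [Module k P] {N : Submodule k M}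
    {φ ψ : BalTensor k A M U →ₗ[k] P}
    (h : ∀ n ∈ N, ∀ u : U, φ (tmul k A n u) = ψ (tmul k A n u)) {x : BalTensor k A M U}
    (hx : x ∈ tensorSpan A U N) : φ x = ψ x :=
  (tensorSpan_le (Q := LinearMap.eqLocus φ ψ)).2 h hx

section Restrict

variable {k : Type*} [CommRing k] {A : Type*} [Ring A] [Algebra k A]
variable {M : Type*} [AddCommGroup M] [Module k M] [Module Aᵐᵒᵖ M] [IsScalarTower k Aᵐᵒᵖ M]
variable {M' : Type*} [AddCommGroup M'] [Module k M'] [Module Aᵐᵒᵖ M'] [IsScalarTower k Aᵐᵒᵖ M']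
variable {U : Type*} [AddCommGroup U] [Module k U] [Module A U]

theorem range_map_subtype (N : Submodule Aᵐᵒᵖ M) :
    LinearMap.range (map (A := A) (N.subtype.restrictScalars k) (LinearMap.id : U →ₗ[k] U)
      (RightComodule.subtype_rsmul N) id_lsmul) = tensorSpan A U (N.restrictScalars k) := by
  refine le_antisymm ?_ (tensorSpan_le.2 fun n hn u => ⟨tmul k A (⟨n, hn⟩ : N) u, by simp⟩)
  rintro _ ⟨x, rfl⟩
  induction x using induction_on with
  | zero => simp
  | add x y hx hy => simpa only [map_add] using add_mem hx hy
  | tmul n u => simpa using tmul_mem_tensorSpan (A := A) (N := N.restrictScalars k) n.2 u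

/-- Right exactness: the kernel of `M ⊗_A U → (M ⧸ N) ⊗_A U` is spanned by the `n ⊗ u`. -/
theorem mem_tensorSpan_of_map_mkQ_eq_zero (N : Submodule Aᵐᵒᵖ M) {x : BalTensor k A M U}
    (hx : map (A := A) (N.mkQ.restrictScalars k) (LinearMap.id : U →ₗ[k] U)
      (fun a m => N.mkQ.map_smul (op a) m) id_lsmul x = 0) :
    x ∈ tensorSpan A U (N.restrictScalars k) := by
  let Q := tensorSpan (k := k) A U (N.restrictScalars k)
  let β : M →ₗ[k] U →ₗ[k] BalTensor k A M U ⧸ Q :=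
    (TensorProduct.mk k M U).compr₂ (Q.mkQ ∘ₗ mk A)
  have hβ : ∀ m u, β m u = Q.mkQ (tmul k A m u) := fun _ _ => rfl
  let γ : (M ⧸ N) →ₗ[k] U →ₗ[k] BalTensor k A M U ⧸ Q :=
    (N.restrictScalars k).liftQ β (fun n hn => by
      ext u
      rw [hβ]
      exact (Submodule.Quotient.mk_eq_zero Q).2 (tmul_mem_tensorSpan hn u)) ∘ₗ
      (Submodule.Quotient.restrictScalarsEquiv k N).symm.toLinearMap
  have hγ : ∀ m u, γ (N.mkQ m) u = Q.mkQ (tmul k A m u) := fun _ _ => rfl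
  let g : BalTensor k A (M ⧸ N) U →ₗ[k] BalTensor k A M U ⧸ Q := lift γ (by
    intro a m u
    obtain ⟨m, rfl⟩ := N.mkQ_surjective m
    rw [← map_smul, hγ, hγ, smul_tmul])
  have key : g ∘ₗ map (A := A) (N.mkQ.restrictScalars k) (LinearMap.id : U →ₗ[k] U)
      (fun a m => N.mkQ.map_smul (op a) m) id_lsmul = Q.mkQ :=
    hom_ext fun m u => by
      simp only [LinearMap.comp_apply]
      exact (lift_tmul _ _ _ _).trans (hγ m u)
  have h := LinearMap.congr_fun key x
  rw [LinearMap.comp_apply, hx, map_zero] at h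
  exact (Submodule.Quotient.mk_eq_zero Q).1 h.symm

end Restrict

end TensorSpan

/-! ### Preimages and intersections under a flat tensor factor -/

section Flat

variable {k : Type u} [CommRing k] {A : Type u} [Ring A] [Algebra k A]
variable {M : Type u} [AddCommGroup M] [Module k M] [Module Aᵐᵒᵖ M] [IsScalarTower k Aᵐᵒᵖ M]
variable {M' : Type u} [AddCommGroup M'] [Module k M'] [Module Aᵐᵒᵖ M'] [IsScalarTower k Aᵐᵒᵖ M']
variable {U : Type u} [AddCommGroup U] [Module k U] [Module A U]

/-- If `U` is flat then tensoring with `U` commutes with preimages of submodules. -/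
theorem mem_tensorSpan_comap (hU : IsLeftFlat k A U) (f : M →ₗ[k] M')
    (hf : ∀ (a : A) m, f (op a • m) = op a • f m) {N : Submodule k M'} (hN : RStable A N)
    {x : BalTensor k A M U} (hx : map f LinearMap.id hf id_lsmul x ∈ tensorSpan A U N) :
    x ∈ tensorSpan A U (N.comap f) := by
  let F : M →ₗ[Aᵐᵒᵖ] M' := { f with map_smul' := fun a m => hf (unop a) m }
  let N' := hN.toSubmodule
  -- The induced map on quotients is injective, and flatness keeps it so after tensoring with `U`.
  -- Hence `x` already vanishes in the quotient by the preimage, and right exactness applies.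
  let G : (M ⧸ N'.comap F) →ₗ[Aᵐᵒᵖ] M' ⧸ N' := (N'.comap F).mapQ N' F le_rfl
  have hG : Function.Injective G := by
    rw [← LinearMap.ker_eq_bot, Submodule.ker_mapQ]
    simp
  refine mem_tensorSpan_of_map_mkQ_eq_zero (N'.comap F)
    (hU _ _ (G.restrictScalars k) (fun a m => G.map_smul (op a) m) hG ?_)
  rw [map_zero]
  have hcomp : ∀ y : BalTensor k A M U,
      map (G.restrictScalars k) (LinearMap.id : U →ₗ[k] U) (fun a m => G.map_smul (op a) m)
        id_lsmul (map (A := A) ((N'.comap F).mkQ.restrictScalars k) (LinearMap.id : U →ₗ[k] U)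
      (fun a m => (N'.comap F).mkQ.map_smul (op a) m) id_lsmul y) =
      map (A := A) (N'.mkQ.restrictScalars k) (LinearMap.id : U →ₗ[k] U)
        (fun a m => N'.mkQ.map_smul (op a) m) id_lsmul (map f LinearMap.id hf id_lsmul y) := by
    intro y
    induction y using induction_on with
    | zero => simp
    | add x y hx hy => simp only [map_add, hx, hy]
    | tmul m u => simp only [map_tmul]; rfl
  rw [hcomp]
  refine (Submodule.mem_bot k).1 (tensorSpan_map_mem (Q := ⊥) _ (fun n hn u => ?_) hx)
  have h0 : N'.mkQ n = 0 := (Submodule.Quotient.mk_eq_zero N').2 hn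
  rw [Submodule.mem_bot]
  refine (map_tmul _ _ _ _ n u).trans ?_
  exact (congrArg (fun z => tmul k A z u) h0).trans (zero_tmul u)

/-- If `U` is flat then tensoring with `U` commutes with intersections of two submodules. -/
theorem mem_tensorSpan_inf (hU : IsLeftFlat k A U) {N N' : Submodule k M} (hN : RStable A N)
    (hN' : RStable A N') {x : BalTensor k A M U} (hx : x ∈ tensorSpan A U N)
    (hx' : x ∈ tensorSpan A U N') : x ∈ tensorSpan A U (N ⊓ N') := by
  let N₁ := hN.toSubmodule
  rw [show N = N₁.restrictScalars k from rfl, ← range_map_subtype] at hx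
  obtain ⟨y, rfl⟩ := hx
  -- The intersection is the preimage of `N'` under the inclusion of `N`, so the case of preimages
  -- applies to a lift `y` of `x`.
  have hy := mem_tensorSpan_comap hU _ _ hN' hx'
  refine tensorSpan_map_mem _ (fun n hn u => ?_) hy
  rw [map_tmul]
  exact tmul_mem_tensorSpan (Submodule.mem_inf.2 ⟨n.2, hn⟩) u

end Flat

end BalTensor

/-! ## Coactions -/

section Coaction

open BalTensor

section General

variable {k : Type*} [CommRing k] {A : Type*} [Ring A]
variable {M : Type*} [AddCommGroup M] [Module k M] [Module Aᵐᵒᵖ M]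
variable {M' : Type*} [AddCommGroup M'] [Module k M'] [Module Aᵐᵒᵖ M']
variable {M'' : Type*} [AddCommGroup M''] [Module k M''] [Module Aᵐᵒᵖ M'']
variable {U : Type*} [AddCommGroup U] [Module k U] [Module A U]

/-- The submodule `N` is stable under the coaction `ρ`. -/
def CoStable (ρ : M →ₗ[k] BalTensor k A M U) (N : Submodule k M) : Prop :=
  ∀ m ∈ N, ρ m ∈ tensorSpan A U N

/-- The map `g` is right `A`-linear and commutes with the coactions. -/
def IsColinear (ρ : M →ₗ[k] BalTensor k A M U) (ρ' : M' →ₗ[k] BalTensor k A M' U)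
    (g : M →ₗ[k] M') : Prop :=
  ∃ hg : ∀ (a : A) m, g (op a • m) = op a • g m,
    ∀ m, ρ' (g m) = map g LinearMap.id hg id_lsmul (ρ m)

theorem RStable.sSup {𝓕 : Set (Submodule k M)} (h : ∀ N ∈ 𝓕, RStable A N) :
    RStable A (sSup 𝓕) := by
  intro a n hn
  rw [sSup_eq_iSup'] at hn ⊢
  induction hn using Submodule.iSup_induction' with
  | mem i x hx => exact (le_iSup (fun N : 𝓕 => (N : Submodule k M)) i) (h i i.2 a x hx)
  | zero => simp
  | add x y _ _ hx hy => simpa only [smul_add] using add_mem hx hy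

theorem RStable.inf {N N' : Submodule k M} (h : RStable A N) (h' : RStable A N') :
    RStable A (N ⊓ N') :=
  fun a n hn => ⟨h a n hn.1, h' a n hn.2⟩

theorem CoStable.sSup {ρ : M →ₗ[k] BalTensor k A M U} {𝓕 : Set (Submodule k M)}
    (h : ∀ N ∈ 𝓕, CoStable ρ N) : CoStable ρ (sSup 𝓕) := by
  have : SupSet.sSup 𝓕 ≤ (tensorSpan A U (SupSet.sSup 𝓕)).comap ρ :=
    sSup_le fun N hN m hm => tensorSpan_mono (le_sSup hN) (h N hN m hm)
  exact this

namespace IsColinear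

variable {ρ : M →ₗ[k] BalTensor k A M U} {ρ' : M' →ₗ[k] BalTensor k A M' U}
  {ρ'' : M'' →ₗ[k] BalTensor k A M'' U}

theorem id : IsColinear ρ ρ LinearMap.id := by
  refine ⟨fun _ _ => rfl, fun m => ?_⟩
  change ρ m = _
  induction ρ m using induction_on with
  | zero => simp
  | add x y hx hy => rw [map_add, ← hx, ← hy]
  | tmul m u => simp

theorem comp {g : M →ₗ[k] M'} {g' : M' →ₗ[k] M''} (h' : IsColinear ρ' ρ'' g')
    (h : IsColinear ρ ρ' g) : IsColinear ρ ρ'' (g' ∘ₗ g) := by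
  obtain ⟨h₁, h₂⟩ := h
  obtain ⟨h₁', h₂'⟩ := h'
  refine ⟨fun a m => by simp [h₁, h₁'], fun m => ?_⟩
  rw [LinearMap.comp_apply, h₂', h₂]
  induction ρ m using induction_on with
  | zero => simp
  | add x y hx hy => simp only [map_add, hx, hy]
  | tmul m u => simp

theorem add {g g' : M →ₗ[k] M'} (h : IsColinear ρ ρ' g) (h' : IsColinear ρ ρ' g') :
    IsColinear ρ ρ' (g + g') := by
  obtain ⟨h₁, h₂⟩ := h
  obtain ⟨h₁', h₂'⟩ := h'
  refine ⟨fun a m => by simp [h₁, h₁'], fun m => ?_⟩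
  rw [LinearMap.add_apply, map_add, h₂', h₂]
  induction ρ m using induction_on with
  | zero => simp
  | add x y hx hy => simp only [map_add, ← hx, ← hy]; abel
  | tmul m u => simp [add_tmul]

theorem zero : IsColinear ρ ρ' 0 := by
  refine ⟨fun a m => by simp, fun m => ?_⟩
  rw [LinearMap.zero_apply, map_zero]
  induction ρ m using induction_on with
  | zero => simp
  | add x y hx hy => simp only [map_add, ← hx, ← hy, add_zero]
  | tmul m u => simp

theorem neg {g : M →ₗ[k] M'} (h : IsColinear ρ ρ' g) : IsColinear ρ ρ' (-g) := by
  obtain ⟨h₁, h₂⟩ := h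
  refine ⟨fun a m => by simp [h₁], fun m => ?_⟩
  rw [LinearMap.neg_apply, map_neg, h₂]
  induction ρ m using induction_on with
  | zero => simp
  | add x y hx hy => simp only [map_add, ← hx, ← hy, neg_add]
  | tmul m u =>
    simp only [map_tmul, LinearMap.neg_apply]
    rw [← neg_one_smul k (g m), smul_tmul', neg_one_smul]

theorem sub {g g' : M →ₗ[k] M'} (h : IsColinear ρ ρ' g) (h' : IsColinear ρ ρ' g') :
    IsColinear ρ ρ' (g - g') := by
  rw [sub_eq_add_neg]
  exact h.add h'.neg

theorem rStable_map {g : M →ₗ[k] M'} (h : IsColinear ρ ρ' g) {N : Submodule k M}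
    (hN : RStable A N) : RStable A (N.map g) := by
  rintro a _ ⟨n, hn, rfl⟩
  exact ⟨op a • n, hN a n hn, h.1 a n⟩

theorem coStable_map {g : M →ₗ[k] M'} (h : IsColinear ρ ρ' g) {N : Submodule k M}
    (hN : CoStable ρ N) : CoStable ρ' (N.map g) := by
  rintro _ ⟨n, hn, rfl⟩
  obtain ⟨h₁, h₂⟩ := h
  rw [h₂]
  refine tensorSpan_map_mem _ (fun n hn u => ?_) (hN n hn)
  rw [map_tmul]
  exact tmul_mem_tensorSpan (Submodule.mem_map_of_mem hn) u

theorem rStable_comap {g : M →ₗ[k] M'} (h : IsColinear ρ ρ' g) {N : Submodule k M'}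
    (hN : RStable A N) : RStable A (N.comap g) := by
  intro a n hn
  rw [Submodule.mem_comap, h.1]
  exact hN a _ hn

/-- A projection onto a stable submodule along a stable complement is colinear. -/
theorem of_isCompl {N N' : Submodule k M} (hN : RStable A N) (hN' : RStable A N')
    (h : CoStable ρ N) (h' : CoStable ρ N') {p : M →ₗ[k] M} (hp : ∀ n ∈ N, p n = n)
    (hp' : ∀ n ∈ N', p n = 0) (htop : N ⊔ N' = ⊤) : IsColinear ρ ρ p := by
  have hdec : ∀ m : M, ∃ n ∈ N, ∃ n' ∈ N', n + n' = m := fun m =>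
    Submodule.mem_sup.1 (htop ▸ Submodule.mem_top)
  have hlin : ∀ (a : A) m, p (op a • m) = op a • p m := by
    intro a m
    obtain ⟨n, hn, n', hn', rfl⟩ := hdec m
    rw [smul_add, map_add, map_add, hp _ hn, hp' _ hn', hp _ (hN a n hn), hp' _ (hN' a n' hn')]
    simp
  refine ⟨hlin, fun m => ?_⟩
  obtain ⟨n, hn, n', hn', rfl⟩ := hdec m
  have e₁ : map p (LinearMap.id : U →ₗ[k] U) hlin id_lsmul (ρ n) = ρ n :=
    eqOn_tensorSpan (ψ := LinearMap.id) (fun n hn u => by simp [hp n hn]) (h n hn)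
  have e₂ : map p (LinearMap.id : U →ₗ[k] U) hlin id_lsmul (ρ n') = 0 :=
    eqOn_tensorSpan (ψ := 0) (fun n hn u => by simp [hp' n hn]) (h' n' hn')
  simp only [map_add, hp n hn, hp' n' hn', e₁, e₂, map_zero]

end IsColinear

end General

section Flat

variable {k : Type u} [CommRing k] {A : Type u} [Ring A] [Algebra k A]
variable {M : Type u} [AddCommGroup M] [Module k M] [Module Aᵐᵒᵖ M] [IsScalarTower k Aᵐᵒᵖ M]
variable {M' : Type u} [AddCommGroup M'] [Module k M'] [Module Aᵐᵒᵖ M'] [IsScalarTower k Aᵐᵒᵖ M']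
variable {U : Type u} [AddCommGroup U] [Module k U] [Module A U]
variable {ρ : M →ₗ[k] BalTensor k A M U} {ρ' : M' →ₗ[k] BalTensor k A M' U}

theorem CoStable.inf (hU : IsLeftFlat k A U) {N N' : Submodule k M} (hN : RStable A N)
    (hN' : RStable A N') (h : CoStable ρ N) (h' : CoStable ρ N') : CoStable ρ (N ⊓ N') :=
  fun m hm => mem_tensorSpan_inf hU hN hN' (h m hm.1) (h' m hm.2)

/-- Images of costable submodules are always costable; preimages need the flatness of `U`, because
membership in a tensor span must be lifted back along `g`. -/
theorem IsColinear.coStable_comap (hU : IsLeftFlat k A U) {g : M →ₗ[k] M'}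
    (hg : IsColinear ρ ρ' g) {N : Submodule k M'} (hN : RStable A N) (h : CoStable ρ' N) :
    CoStable ρ (N.comap g) := by
  intro m hm
  obtain ⟨h₁, h₂⟩ := hg
  refine mem_tensorSpan_comap hU g h₁ hN ?_
  rw [← h₂]
  exact h _ hm

end Flat

end Coaction

namespace BalTensor

/-- The map `m ↦ m ⊗ u`. -/
def tmulRight (k : Type*) [CommRing k] (A : Type*) [Ring A] (M : Type*) [AddCommGroup M]
    [Module k M] [Module Aᵐᵒᵖ M] {U : Type*} [AddCommGroup U] [Module k U] [Module A U] (u : U) :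
    M →ₗ[k] BalTensor k A M U :=
  ⟨⟨fun m => tmul k A m u, fun m m' => add_tmul m m' u⟩, fun c m => smul_tmul' c m u⟩

theorem tmulRight_apply {k : Type*} [CommRing k] {A : Type*} [Ring A] {M : Type*}
    [AddCommGroup M] [Module k M] [Module Aᵐᵒᵖ M] {U : Type*} [AddCommGroup U] [Module k U]
    [Module A U] (u : U) (m : M) : tmulRight k A M u m = tmul k A m u := rfl

end BalTensor

/-! ## Averaging over a coseparable coring -/

section Coseparable

open BalTensor

variable {k : Type*} [CommRing k] {A : Type*} [Ring A] [Algebra k A]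
variable {C : Type*} [AddCommGroup C] [Module k C] [Module A C] [Module Aᵐᵒᵖ C]
  [SMulCommClass A Aᵐᵒᵖ C] [IsScalarTower k A C] [IsScalarTower k Aᵐᵒᵖ C]

/-- A form `γ : C ⊗_A C → A` as in the characterization of coseparability by cointegrals. -/
structure Coring.Cointegral (𝒞 : Coring k A C) where
  /-- The underlying bilinear form. -/
  form : BalTensor k A C C →ₗ[k] A
  form_lsmul : ∀ (a : A) (x : BalTensor k A C C), form (a • x) = a • form x
  form_rsmul : ∀ (a : A) (x : BalTensor k A C C), form (op a • x) = op a • form x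
  form_comul : ∀ c, form (𝒞.comul c) = 𝒞.counit c
  form_balanced : ∀ c c' : C,
    lid k A C (map form LinearMap.id form_rsmul id_lsmul
      ((assoc k A C C C).symm (tmul k A c (𝒞.comul c')))) =
    rid k A C (map LinearMap.id form id_rsmul form_lsmul
      (assoc k A C C C (tmul k A (𝒞.comul c) c')))

/-- The form is `γ = ε π`. Right and left colinearity of `π`, each followed by a counit, give the
two sides of the balancing identity, and both equal `π (c ⊗ c')`. -/
theorem Coring.IsCoseparable.exists_cointegral {𝒞 : Coring k A C} (h : 𝒞.IsCoseparable) :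
    Nonempty 𝒞.Cointegral := by
  obtain ⟨π, hl, hr, h₁, h₂, h₃⟩ := h
  have hγl : ∀ (a : A) (x : BalTensor k A C C),
      (𝒞.counit ∘ₗ π) (a • x) = a • (𝒞.counit ∘ₗ π) x := fun a x => by
    simp only [LinearMap.comp_apply, hl, 𝒞.counit_lsmul]
  have hγr : ∀ (a : A) (x : BalTensor k A C C),
      (𝒞.counit ∘ₗ π) (op a • x) = op a • (𝒞.counit ∘ₗ π) x := fun a x => by
    simp only [LinearMap.comp_apply, hr, 𝒞.counit_rsmul]
  refine ⟨⟨𝒞.counit ∘ₗ π, hγl, hγr, fun c => by rw [LinearMap.comp_apply, h₃], fun c c' => ?_⟩⟩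
  trans π (tmul k A c c')
  · rw [← 𝒞.lid_comul (π (tmul k A c c')), h₂, map_tmul, LinearMap.id_apply]
    congr 1
    induction (assoc k A C C C).symm (tmul k A c (𝒞.comul c')) using induction_on with
    | zero => simp
    | add x y hx hy => simp only [map_add, hx, hy]
    | tmul x y => simp
  · rw [← 𝒞.rid_comul (π (tmul k A c c')), h₁, map_tmul, LinearMap.id_apply]
    congr 1
    induction (assoc k A C C C) (tmul k A (𝒞.comul c) c') using induction_on with
    | zero => simp
    | add x y hx hy => simp only [map_add, hx, hy]
    | tmul x y => simp

namespace Coring.Cointegral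

variable {𝒞 : Coring k A C} (γ : 𝒞.Cointegral)
variable (M : Type*) [AddCommGroup M] [Module k M] [Module Aᵐᵒᵖ M] [IsScalarTower k Aᵐᵒᵖ M]

/-- The map `(m ⊗ c) ⊗ c' ↦ m γ(c ⊗ c')`. -/
def contract : BalTensor k A (BalTensor k A M C) C →ₗ[k] M :=
  rid k A M ∘ₗ map LinearMap.id γ.form id_rsmul γ.form_lsmul ∘ₗ (assoc k A M C C).toLinearMap

variable {M}

@[simp]
theorem contract_tmul (m : M) (c c' : C) :
    γ.contract M (tmul k A (tmul k A m c) c') = op (γ.form (tmul k A c c')) • m := by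
  simp [contract]

theorem contract_rsmul (a : A) (x : BalTensor k A (BalTensor k A M C) C) :
    γ.contract M (op a • x) = op a • γ.contract M x := by
  induction x using induction_on with
  | zero => simp
  | add x y hx hy => simp only [smul_add, map_add, hx, hy]
  | tmul y c' =>
    induction y using induction_on with
    | zero => simp
    | add x y hx hy => simp only [add_tmul, smul_add, map_add, hx, hy]
    | tmul m c =>
      rw [rsmul_tmul, contract_tmul, contract_tmul, ← rsmul_tmul, γ.form_rsmul, smul_smul,
        op_smul_eq_mul, op_mul]

/-- The map `M ⊗_A C → M`, `m ⊗ c ↦ m₀ γ(m₁ ⊗ c)`. -/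
def retract (ρ : RightComodule 𝒞 M) : BalTensor k A M C →ₗ[k] M :=
  γ.contract M ∘ₗ map ρ.coact LinearMap.id ρ.coact_rsmul id_lsmul

theorem retract_tmul (ρ : RightComodule 𝒞 M) (m : M) (c : C) :
    γ.retract ρ (tmul k A m c) = γ.contract M (tmul k A (ρ.coact m) c) := by
  simp [retract]

theorem retract_rsmul (ρ : RightComodule 𝒞 M) (a : A) (x : BalTensor k A M C) :
    γ.retract ρ (op a • x) = op a • γ.retract ρ x := by
  rw [retract, LinearMap.comp_apply, LinearMap.comp_apply, ← contract_rsmul]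
  congr 1
  induction x using induction_on with
  | zero => simp
  | add x y hx hy => simp only [smul_add, map_add, hx, hy]
  | tmul m c => simp

/-- Coassociativity turns `m₀₀ γ(m₀₁ ⊗ m₁)` into `m₀ γ(m₁₁ ⊗ m₁₂)`. Since `γ Δ = ε`, this is `m₀
ε(m₁) = m`. -/
theorem retract_coact (ρ : RightComodule 𝒞 M) (m : M) : γ.retract ρ (ρ.coact m) = m := by
  rw [retract, contract, LinearMap.comp_apply, LinearMap.comp_apply, LinearMap.comp_apply,
    LinearEquiv.coe_coe, ← ρ.coassoc]
  conv_rhs => rw [← ρ.rid_coact m]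
  congr 1
  induction ρ.coact m using induction_on with
  | zero => simp
  | add x y hx hy => simp only [map_add, hx, hy]
  | tmul m c => simp [γ.form_comul]

theorem contract_mem {N : Submodule k M} (hN : RStable A N) {y : BalTensor k A M C}
    (hy : y ∈ tensorSpan A C N) (c : C) : γ.contract M (tmul k A y c) ∈ N := by
  refine tensorSpan_map_mem (γ.contract M ∘ₗ tmulRight k A _ c) (fun n hn c' => ?_) hy
  rw [LinearMap.comp_apply, tmulRight_apply, contract_tmul]
  exact hN _ n hn

theorem retract_mem {ρ : RightComodule 𝒞 M} {N : Submodule k M} (hN : RStable A N)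
    (hρ : CoStable ρ.coact N) {x : BalTensor k A M C} (hx : x ∈ tensorSpan A C N) :
    γ.retract ρ x ∈ N :=
  tensorSpan_map_mem _ (fun n hn c => by
    rw [retract_tmul]
    exact γ.contract_mem hN (hρ n hn) c) hx

end Coring.Cointegral

/-- The cofree coaction on `M ⊗_A C`. -/
def Coring.cofreeCoact (𝒞 : Coring k A C) (M : Type*) [AddCommGroup M] [Module k M]
    [Module Aᵐᵒᵖ M] [IsScalarTower k Aᵐᵒᵖ M] :
    BalTensor k A M C →ₗ[k] BalTensor k A (BalTensor k A M C) C :=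
  (assoc k A M C C).symm.toLinearMap ∘ₗ map LinearMap.id 𝒞.comul id_rsmul 𝒞.comul_lsmul

/-! ### Comodules as retracts of cofree comodules -/

section Cofree

variable {𝒞 : Coring k A C} (γ : 𝒞.Cointegral)
variable {M : Type*} [AddCommGroup M] [Module k M] [Module Aᵐᵒᵖ M] [IsScalarTower k Aᵐᵒᵖ M]

theorem Coring.cofreeCoact_tmul (m : M) (c : C) : 𝒞.cofreeCoact M (tmul k A m c) =
    (assoc k A M C C).symm (tmul k A m (𝒞.comul c)) := by
  simp [Coring.cofreeCoact]

/-- This is coassociativity of the coaction, read as colinearity of `ρ` into the cofree comodule. -/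
theorem RightComodule.isColinear_coact (ρ : RightComodule 𝒞 M) :
    IsColinear ρ.coact (𝒞.cofreeCoact M) ρ.coact := by
  refine ⟨ρ.coact_rsmul, fun m => ?_⟩
  rw [Coring.cofreeCoact, LinearMap.comp_apply, ρ.coassoc, LinearEquiv.coe_coe,
    LinearEquiv.symm_apply_apply]

theorem Coring.isColinear_map {M' : Type*} [AddCommGroup M'] [Module k M'] [Module Aᵐᵒᵖ M']
    [IsScalarTower k Aᵐᵒᵖ M'] (f : M →ₗ[k] M') (hf : ∀ (a : A) m, f (op a • m) = op a • f m) :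
    IsColinear (𝒞.cofreeCoact M) (𝒞.cofreeCoact M') (map f LinearMap.id hf id_lsmul) := by
  have hlin : ∀ (a : A) (x : BalTensor k A M C), map f (LinearMap.id : C →ₗ[k] C) hf id_lsmul
      (op a • x) = op a • map f (LinearMap.id : C →ₗ[k] C) hf id_lsmul x := by
    intro a x
    induction x using induction_on with
    | zero => simp
    | add x y hx hy => simp only [smul_add, map_add, hx, hy]
    | tmul m c => simp
  refine ⟨hlin, fun x => ?_⟩
  induction x using induction_on with
  | zero => simp
  | add x y hx hy => simp only [map_add, hx, hy]
  | tmul m c =>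
    rw [map_tmul, LinearMap.id_apply, Coring.cofreeCoact_tmul, Coring.cofreeCoact_tmul]
    induction 𝒞.comul c using induction_on with
    | zero => simp
    | add x y hx hy => simp only [tmul_add, map_add, hx, hy]
    | tmul x y => simp

namespace Coring.Cointegral

/-- With `z = Δ c'`, the right-hand factor is one side of the balancing identity `c₁ γ(c₂ ⊗ c') =
γ(c ⊗ c'₁) c'₂`; `map_contract_assoc_symm` produces the other side. -/
theorem contract_assoc_symm (m : M) (z : BalTensor k A C C) (c : C) :
    γ.contract (BalTensor k A M C) (tmul k A ((assoc k A M C C).symm (tmul k A m z)) c) =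
      tmul k A m (rid k A C (map LinearMap.id γ.form id_rsmul γ.form_lsmul
        (assoc k A C C C (tmul k A z c)))) := by
  induction z using induction_on with
  | zero => simp
  | add x y hx hy => simp only [tmul_add, add_tmul, map_add, hx, hy]
  | tmul x y => simp

theorem map_contract_assoc_symm (m : M) (c : C) (z : BalTensor k A C C) :
    map (γ.contract M) (LinearMap.id : C →ₗ[k] C) γ.contract_rsmul id_lsmul
      ((assoc k A (BalTensor k A M C) C C).symm (tmul k A (tmul k A m c) z)) =
      tmul k A m (lid k A C (map γ.form LinearMap.id γ.form_rsmul id_lsmul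
        ((assoc k A C C C).symm (tmul k A c z)))) := by
  induction z using induction_on with
  | zero => simp
  | add x y hx hy => simp only [tmul_add, map_add, hx, hy]
  | tmul x y => simp [smul_tmul]

theorem coact_contract (ρ : RightComodule 𝒞 M) (y : BalTensor k A M C) (c : C) :
    ρ.coact (γ.contract M (tmul k A y c)) = γ.contract (BalTensor k A M C)
      (tmul k A (map ρ.coact LinearMap.id ρ.coact_rsmul id_lsmul y) c) := by
  induction y using induction_on with
  | zero => simp
  | add x y hx hy => simp only [add_tmul, map_add, hx, hy]
  | tmul m c' => rw [contract_tmul, map_tmul, contract_tmul, ρ.coact_rsmul, LinearMap.id_apply]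

/-- On `m ⊗ c`, the claim is `m₀ ⊗ m₁ γ(m₂ ⊗ c) = m₀ γ(m₁ ⊗ c₁) ⊗ c₂`, which is the balancing
identity of `γ` applied to `m₁` and `c`. Together with `retract_coact`, the comodule `M` becomes a
colinear retract of the cofree comodule `M ⊗_A C`. -/
theorem isColinear_retract (ρ : RightComodule 𝒞 M) :
    IsColinear (𝒞.cofreeCoact M) ρ.coact (γ.retract ρ) := by
  refine ⟨γ.retract_rsmul ρ, fun x => ?_⟩
  induction x using induction_on with
  | zero => simp
  | add x y hx hy => simp only [map_add, hx, hy]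
  | tmul m c =>
    have h₁ : map ρ.coact LinearMap.id ρ.coact_rsmul id_lsmul (ρ.coact m) =
        𝒞.cofreeCoact M (ρ.coact m) := by
      obtain ⟨_, h⟩ := ρ.isColinear_coact
      exact (h m).symm
    have h₂ : ∀ z : BalTensor k A C C,
        map (γ.retract ρ) (LinearMap.id : C →ₗ[k] C) (γ.retract_rsmul ρ) id_lsmul
          ((assoc k A M C C).symm (tmul k A m z)) =
        map (γ.contract M) (LinearMap.id : C →ₗ[k] C) γ.contract_rsmul id_lsmul
          ((assoc k A (BalTensor k A M C) C C).symm (tmul k A (ρ.coact m) z)) := by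
      intro z
      induction z using induction_on with
      | zero => simp
      | add x y hx hy => simp only [tmul_add, map_add, hx, hy]
      | tmul x y => simp [retract_tmul]
    rw [retract_tmul, coact_contract, Coring.cofreeCoact_tmul, h₁, h₂]
    induction ρ.coact m using induction_on with
    | zero => simp
    | add x y hx hy => simp only [add_tmul, map_add, hx, hy]
    | tmul m c' =>
      rw [Coring.cofreeCoact_tmul, contract_assoc_symm, map_contract_assoc_symm, γ.form_balanced]

/-- The average of a right `A`-linear map over a coseparable coring. -/
def average (ρ : RightComodule 𝒞 M) (f : M →ₗ[k] M)
    (hf : ∀ (a : A) m, f (op a • m) = op a • f m) : M →ₗ[k] M :=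
  γ.retract ρ ∘ₗ map f LinearMap.id hf id_lsmul ∘ₗ ρ.coact

/-- For a merely `A`-linear `f`, the map `f ⊗ C` is colinear between cofree comodules, and so are
the coaction before it and the retraction after it. -/
theorem isColinear_average (ρ : RightComodule 𝒞 M) (f : M →ₗ[k] M)
    (hf : ∀ (a : A) m, f (op a • m) = op a • f m) :
    IsColinear ρ.coact ρ.coact (γ.average ρ f hf) :=
  (γ.isColinear_retract ρ).comp ((Coring.isColinear_map f hf).comp ρ.isColinear_coact)

theorem average_eq_self {ρ : RightComodule 𝒞 M} {f : M →ₗ[k] M}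
    {hf : ∀ (a : A) m, f (op a • m) = op a • f m} {N : Submodule k M}
    (hρ : CoStable ρ.coact N) (hN : ∀ n ∈ N, f n = n) {n : M} (hn : n ∈ N) :
    γ.average ρ f hf n = n := by
  have e : map f (LinearMap.id : C →ₗ[k] C) hf id_lsmul (ρ.coact n) = ρ.coact n :=
    eqOn_tensorSpan (ψ := LinearMap.id) (fun n hn u => by simp [hN n hn]) (hρ n hn)
  rw [average, LinearMap.comp_apply, LinearMap.comp_apply, e, retract_coact]

theorem average_mem {ρ : RightComodule 𝒞 M} {f : M →ₗ[k] M}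
    {hf : ∀ (a : A) m, f (op a • m) = op a • f m} {N : Submodule k M} (hN : RStable A N)
    (hρ : CoStable ρ.coact N) (hfN : ∀ m, f m ∈ N) (m : M) : γ.average ρ f hf m ∈ N := by
  refine γ.retract_mem hN hρ ?_
  rw [LinearMap.comp_apply]
  induction ρ.coact m using induction_on with
  | zero => simp
  | add x y hx hy => rw [map_add]; exact add_mem hx hy
  | tmul m c => rw [map_tmul]; exact tmul_mem_tensorSpan (hfN m) _

end Coring.Cointegral

end Cofree

end Coseparable

/-! ## Averaging over a separable algebra -/

section Separable

variable {k : Type*} [CommRing k] {A : Type*} [Ring A] [Algebra k A]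

/-- Take `e = θ 1`: bilinearity of `θ` makes both `a e` and `e a` equal to `θ a`. -/
theorem IsSeparableAlgebra.exists_idempotent (h : IsSeparableAlgebra k A) :
    ∃ e : A ⊗[k] A, LinearMap.mul' k A e = 1 ∧
      ∀ a : A, (a ⊗ₜ[k] 1) * e = e * (1 ⊗ₜ[k] a) := by
  obtain ⟨θ, h₁, h₂⟩ := h
  refine ⟨θ 1, h₂ 1, fun a => ?_⟩
  have e₁ := h₁ a 1 1
  have e₂ := h₁ 1 1 a
  rw [← Algebra.TensorProduct.one_def, mul_one, mul_one, mul_one] at e₁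
  rw [← Algebra.TensorProduct.one_def, one_mul, one_mul, one_mul] at e₂
  rw [← e₁, ← e₂]

variable {M : Type*} [AddCommGroup M] [Module k M] [Module Aᵐᵒᵖ M] [IsScalarTower k Aᵐᵒᵖ M]

/-- The map `m ↦ ∑ f (m x) y` for a tensor `∑ x ⊗ y`. -/
def sandwich (f : M →ₗ[k] M) : A ⊗[k] A →ₗ[k] M →ₗ[k] M :=
  TensorProduct.lift (LinearMap.mk₂ k
    (fun x y : A => Algebra.lsmul k k M (op y) ∘ₗ f ∘ₗ Algebra.lsmul k k M (op x))
    (fun x x' y => by ext m; simp)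
    (fun r x y => by ext m; simpa using smul_comm (op y) r (f (op x • m)))
    (fun x y y' => by ext m; simp)
    (fun r x y => by ext m; simp))

theorem sandwich_tmul (f : M →ₗ[k] M) (x y : A) (m : M) :
    sandwich f (x ⊗ₜ[k] y) m = op y • f (op x • m) := rfl

/-- Together with `rsmul_sandwich` this reduces right `A`-linearity of `sandwich f e` to the
identity `(a ⊗ 1) e = e (1 ⊗ a)`. -/
theorem sandwich_rsmul (f : M →ₗ[k] M) (t : A ⊗[k] A) (a : A) (m : M) :
    sandwich f t (op a • m) = sandwich f ((a ⊗ₜ[k] 1) * t) m := by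
  induction t using TensorProduct.induction_on with
  | zero => simp
  | add s t hs ht => simp only [mul_add, map_add, LinearMap.add_apply, hs, ht]
  | tmul x y => simp [sandwich_tmul, mul_smul]

theorem rsmul_sandwich (f : M →ₗ[k] M) (t : A ⊗[k] A) (a : A) (m : M) :
    op a • sandwich f t m = sandwich f (t * (1 ⊗ₜ[k] a)) m := by
  induction t using TensorProduct.induction_on with
  | zero => simp
  | add s t hs ht => simp only [add_mul, map_add, LinearMap.add_apply, smul_add, hs, ht]
  | tmul x y => simp [sandwich_tmul, mul_smul]

theorem sandwich_eq_self {f : M →ₗ[k] M} {N : Submodule k M} (hN : RStable A N)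
    (hf : ∀ n ∈ N, f n = n) (t : A ⊗[k] A) {n : M} (hn : n ∈ N) :
    sandwich f t n = op (LinearMap.mul' k A t) • n := by
  induction t using TensorProduct.induction_on with
  | zero => simp
  | add s t hs ht => simp only [map_add, LinearMap.add_apply, op_add, add_smul, hs, ht]
  | tmul x y => simp [sandwich_tmul, hf _ (hN x n hn), mul_smul]

theorem sandwich_mem {f : M →ₗ[k] M} {N : Submodule k M} (hN : RStable A N)
    (hf : ∀ m, f m ∈ N) (t : A ⊗[k] A) (m : M) : sandwich f t m ∈ N := by
  induction t using TensorProduct.induction_on with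
  | zero => simp
  | add s t hs ht => simpa only [map_add, LinearMap.add_apply] using add_mem hs ht
  | tmul x y => exact hN y _ (hf _)

variable {C : Type*} [AddCommGroup C] [Module k C] [Module A C] [IsScalarTower k A C]

/-- The bilinear map `(m, c) ↦ ∑ m x ⊗ y c` for a tensor `∑ x ⊗ y`. -/
def splitAux (M C : Type*) [AddCommGroup M] [Module k M] [Module Aᵐᵒᵖ M] [IsScalarTower k Aᵐᵒᵖ M]
    [AddCommGroup C] [Module k C] [Module A C] [IsScalarTower k A C] :
    A ⊗[k] A →ₗ[k] M →ₗ[k] C →ₗ[k] M ⊗[k] C :=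
  TensorProduct.lift (LinearMap.mk₂ k
    (fun x y : A => (TensorProduct.mk k M C).compl₁₂ (Algebra.lsmul k k M (op x))
      (Algebra.lsmul k k C y))
    (fun x x' y => by ext m; simp)
    (fun r x y => by ext m; simp [TensorProduct.smul_tmul'])
    (fun x y y' => by ext m; simp [TensorProduct.tmul_add])
    (fun r x y => by ext m; simp))

theorem splitAux_tmul (x y : A) (m : M) (c : C) :
    splitAux M C (x ⊗ₜ[k] y) m c = (op x • m) ⊗ₜ[k] (y • c) := rfl

theorem splitAux_rsmul (t : A ⊗[k] A) (a : A) (m : M) (c : C) :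
    splitAux M C t (op a • m) c = splitAux M C ((a ⊗ₜ[k] 1) * t) m c := by
  induction t using TensorProduct.induction_on with
  | zero => simp
  | add s t hs ht => simp only [mul_add, map_add, LinearMap.add_apply, hs, ht]
  | tmul x y => simp [splitAux_tmul, mul_smul]

theorem splitAux_lsmul (t : A ⊗[k] A) (a : A) (m : M) (c : C) :
    splitAux M C t m (a • c) = splitAux M C (t * (1 ⊗ₜ[k] a)) m c := by
  induction t using TensorProduct.induction_on with
  | zero => simp
  | add s t hs ht => simp only [add_mul, map_add, LinearMap.add_apply, hs, ht]
  | tmul x y => simp [splitAux_tmul, mul_smul]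

/-- For a separability idempotent the multiplied-out tensor is `1`, so `splitAux` gives a section of
`M ⊗ C → M ⊗_A C`. -/
theorem mk_splitAux (t : A ⊗[k] A) (m : M) (c : C) :
    BalTensor.mk A (splitAux M C t m c) =
      BalTensor.tmul k A (op (LinearMap.mul' k A t) • m) c := by
  induction t using TensorProduct.induction_on with
  | zero => simp
  | add s t hs ht =>
    simp only [map_add, LinearMap.add_apply, op_add, add_smul, BalTensor.add_tmul, hs, ht]
  | tmul x y =>
    rw [splitAux_tmul]
    change BalTensor.tmul k A _ _ = _
    rw [← BalTensor.smul_tmul]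
    simp [mul_smul]

theorem splitAux_mem {N : Submodule k M} (hN : RStable A N) (t : A ⊗[k] A) {n : M} (hn : n ∈ N)
    (c : C) : splitAux M C t n c ∈ tensorRange C N := by
  induction t using TensorProduct.induction_on with
  | zero => simp
  | add s t hs ht => simpa only [map_add, LinearMap.add_apply] using add_mem hs ht
  | tmul x y => exact tmul_mem_tensorRange (hN x n hn) _

/-- Over a separable algebra, `M ⊗_A C` is a natural direct summand of `M ⊗ C`, so tensoring with
`C` commutes with intersections of members of a semisimple family. -/
theorem IsSeparableAlgebra.mem_tensorSpan_sInf (hA : IsSeparableAlgebra k A)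
    {𝓛 : Set (Submodule k M)} (h : IsSemisimpleFamily 𝓛) {𝓕 : Set (Submodule k M)}
    (h𝓕 : 𝓕 ⊆ 𝓛) (hst : ∀ N ∈ 𝓕, RStable A N) {x : BalTensor k A M C}
    (hx : ∀ N ∈ 𝓕, x ∈ BalTensor.tensorSpan A C N) :
    x ∈ BalTensor.tensorSpan A C (sInf 𝓕) := by
  obtain ⟨e, he, hea⟩ := hA.exists_idempotent
  -- The section `m ⊗ c ↦ ∑ m x ⊗ y c` is well defined on `M ⊗_A C` because `e` commutes with `A`.
  -- It preserves the part coming from each `A`-stable `N`, so the problem moves to `M ⊗_k C` and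
  -- back.
  let ι : BalTensor k A M C →ₗ[k] M ⊗[k] C := BalTensor.lift (splitAux M C e) (fun a m c => by
    rw [splitAux_rsmul, splitAux_lsmul, hea])
  have hι : ∀ m c, ι (BalTensor.tmul k A m c) = splitAux M C e m c := fun m c =>
    BalTensor.lift_tmul _ _ _ _
  have hmk : BalTensor.mk A ∘ₗ ι = LinearMap.id := BalTensor.hom_ext fun m c => by
    rw [LinearMap.comp_apply, hι, mk_splitAux, he]
    simp
  have key : ι x ∈ tensorRange C (sInf 𝓕) := h.mem_tensorRange_sInf h𝓕 fun N hN =>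
    BalTensor.tensorSpan_map_mem ι (fun n hn c => by
      rw [hι]
      exact splitAux_mem (hst N hN) e hn c) (hx N hN)
  rw [← LinearMap.id_apply (R := k) x, ← hmk]
  exact tensorRange_map_mem _ (fun n hn c => BalTensor.tmul_mem_tensorSpan hn c) key

end Separable

/-! ## The two coactions on `C ⊗ D` -/

section TensorCoaction

open BalTensor

variable {k : Type*} [CommRing k] {A : Type*} [Ring A] [Algebra k A]
  {B : Type*} [Ring B] [Algebra k B]
variable {C : Type*} [AddCommGroup C] [Module k C]
variable {D : Type*} [AddCommGroup D] [Module k D]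

section SecondAction

variable [Module Bᵐᵒᵖ D] [IsScalarTower k Bᵐᵒᵖ D]

/-- The right action of `B` on `C ⊗ D` through the second factor. -/
instance (priority := 40) tensorSecondRightModule : Module Bᵐᵒᵖ (C ⊗[k] D) :=
  Module.compHom (C ⊗[k] D)
    ((Module.End.lTensorAlgHom k D C).comp (Algebra.lsmul k k D)).toRingHom

theorem second_rsmul_def (b : Bᵐᵒᵖ) (x : C ⊗[k] D) :
    b • x = LinearMap.lTensor C (Algebra.lsmul k k D b) x := rfl

@[simp]
theorem second_rsmul_tmul (b : Bᵐᵒᵖ) (c : C) (d : D) :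
    b • (c ⊗ₜ[k] d) = c ⊗ₜ[k] (b • d) := rfl

instance (priority := 40) tensorSecondScalarTower : IsScalarTower k Bᵐᵒᵖ (C ⊗[k] D) where
  smul_assoc r t x := by
    rw [second_rsmul_def, second_rsmul_def, map_smul, LinearMap.lTensor_smul,
      LinearMap.smul_apply]

end SecondAction

/-! ### The coaction on the first factor -/

section First

variable [Module A C] [Module Aᵐᵒᵖ C]
  [SMulCommClass A Aᵐᵒᵖ C] [IsScalarTower k A C] [IsScalarTower k Aᵐᵒᵖ C]

variable (C) in
/-- The map `c ↦ c ⊗ d`. -/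
def tensorRightIncl (d : D) : C →ₗ[k] C ⊗[k] D := (TensorProduct.mk k C D).flip d

@[simp]
theorem tensorRightIncl_apply (d : D) (c : C) : tensorRightIncl (k := k) C d c = c ⊗ₜ d := rfl

theorem tensorRightIncl_rsmul (d : D) (a : A) (c : C) :
    tensorRightIncl (k := k) C d (op a • c) = op a • tensorRightIncl (k := k) C d c := rfl

/-- The map `C ⊗_A U → (C ⊗ D) ⊗_A U`, `c ⊗ u ↦ (c ⊗ d) ⊗ u`. -/
def firstIncl (U : Type*) [AddCommGroup U] [Module k U] [Module A U] (d : D) :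
    BalTensor k A C U →ₗ[k] BalTensor k A (C ⊗[k] D) U :=
  map (tensorRightIncl C d) LinearMap.id (tensorRightIncl_rsmul d) id_lsmul

@[simp]
theorem firstIncl_tmul {U : Type*} [AddCommGroup U] [Module k U] [Module A U] (d : D) (c : C)
    (u : U) : firstIncl U d (tmul k A c u) = tmul k A (c ⊗ₜ[k] d) u := by
  simp [firstIncl]

theorem firstIncl_add {U : Type*} [AddCommGroup U] [Module k U] [Module A U] (d d' : D)
    (x : BalTensor k A C U) : firstIncl U (d + d') x = firstIncl U d x + firstIncl U d' x := by
  induction x using induction_on with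
  | zero => simp
  | add x y hx hy => simp only [map_add, hx, hy]; abel
  | tmul c u => simp [TensorProduct.tmul_add, add_tmul]

theorem firstIncl_smul {U : Type*} [AddCommGroup U] [Module k U] [Module A U] (r : k) (d : D)
    (x : BalTensor k A C U) : firstIncl U (r • d) x = r • firstIncl U d x := by
  induction x using induction_on with
  | zero => simp
  | add x y hx hy => simp only [map_add, hx, hy, smul_add]
  | tmul c u => simp [smul_tmul']

namespace Coring

/-- The coaction `c ⊗ d ↦ (c₁ ⊗ d) ⊗ c₂` of `𝒞` on `C ⊗ D`. -/
def firstCoact (𝒞 : Coring k A C) (D : Type*) [AddCommGroup D] [Module k D] :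
    C ⊗[k] D →ₗ[k] BalTensor k A (C ⊗[k] D) C :=
  TensorProduct.lift (LinearMap.mk₂ k (fun c d => firstIncl C d (𝒞.comul c))
    (fun c c' d => by rw [map_add, map_add]) (fun r c d => by rw [map_smul, map_smul])
    (fun c d d' => firstIncl_add d d' _) (fun r c d => firstIncl_smul r d _))

@[simp]
theorem firstCoact_tmul (𝒞 : Coring k A C) (c : C) (d : D) :
    𝒞.firstCoact D (c ⊗ₜ[k] d) = firstIncl C d (𝒞.comul c) := rfl

theorem firstCoact_rsmul (𝒞 : Coring k A C) (a : A) (x : C ⊗[k] D) :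
    𝒞.firstCoact D (op a • x) = op a • 𝒞.firstCoact D x := by
  induction x using TensorProduct.induction_on with
  | zero => simp
  | add x y hx hy => simp only [smul_add, map_add, hx, hy]
  | tmul c d =>
    rw [TensorProduct.smul_tmul', firstCoact_tmul, firstCoact_tmul, 𝒞.comul_rsmul]
    induction 𝒞.comul c using induction_on with
    | zero => simp
    | add x y hx hy => simp only [smul_add, map_add, hx, hy]
    | tmul c c' => simp

/-- `C ⊗ D` as a right comodule over `𝒞`. -/
def firstComodule (𝒞 : Coring k A C) (D : Type*) [AddCommGroup D] [Module k D] :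
    RightComodule 𝒞 (C ⊗[k] D) where
  coact := 𝒞.firstCoact D
  coact_rsmul := 𝒞.firstCoact_rsmul
  coassoc x := by
    induction x using TensorProduct.induction_on with
    | zero => simp
    | add x y hx hy => simp only [map_add, hx, hy]
    | tmul c d =>
      have h₁ : ∀ y : BalTensor k A C C,
          map LinearMap.id 𝒞.comul id_rsmul 𝒞.comul_lsmul (firstIncl C d y) =
          firstIncl _ d (map LinearMap.id 𝒞.comul id_rsmul 𝒞.comul_lsmul y) := by
        intro y
        induction y using induction_on with
        | zero => simp
        | add x y hx hy => simp only [map_add, hx, hy]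
        | tmul c c' => simp
      have h₂ : ∀ (z : BalTensor k A C C) (c' : C),
          assoc k A (C ⊗[k] D) C C (tmul k A (firstIncl C d z) c') =
          firstIncl _ d (assoc k A C C C (tmul k A z c')) := by
        intro z c'
        induction z using induction_on with
        | zero => simp
        | add x y hx hy => simp only [map_add, add_tmul, hx, hy]
        | tmul c c' => simp
      have h₃ : ∀ y : BalTensor k A C C,
          assoc k A (C ⊗[k] D) C C (map (𝒞.firstCoact D) LinearMap.id 𝒞.firstCoact_rsmul id_lsmul
            (firstIncl C d y)) = firstIncl _ d (assoc k A C C C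
              (map 𝒞.comul LinearMap.id 𝒞.comul_rsmul id_lsmul y)) := by
        intro y
        induction y using induction_on with
        | zero => simp
        | add x y hx hy => simp only [map_add, hx, hy]
        | tmul c c' => simp [h₂]
      rw [firstCoact_tmul, h₁, h₃, 𝒞.coassoc]
  rid_coact x := by
    induction x using TensorProduct.induction_on with
    | zero => simp
    | add x y hx hy => simp only [map_add, hx, hy]
    | tmul c d =>
      have h : ∀ y : BalTensor k A C C, rid k A (C ⊗[k] D)
          (map LinearMap.id 𝒞.counit id_rsmul 𝒞.counit_lsmul (firstIncl C d y)) =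
          rid k A C (map LinearMap.id 𝒞.counit id_rsmul 𝒞.counit_lsmul y) ⊗ₜ d := by
        intro y
        induction y using induction_on with
        | zero => simp
        | add x y hx hy => simp only [map_add, TensorProduct.add_tmul, hx, hy]
        | tmul c c' => simp [TensorProduct.smul_tmul']
      rw [firstCoact_tmul, h, 𝒞.rid_comul]

/-- For fixed `c`, retracting affects only the first tensor factor. Such maps commute with the
`D`-coaction, which is why averaging over `C` does not spoil `D`-colinearity. -/
theorem Cointegral.retract_firstComodule_tmul {𝒞 : Coring k A C} (γ : 𝒞.Cointegral) (x : C ⊗[k] D)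
    (c : C) : γ.retract (𝒞.firstComodule D) (tmul k A x c) =
      LinearMap.rTensor D (γ.retract 𝒞.regular ∘ₗ tmulRight k A C c) x := by
  induction x using TensorProduct.induction_on with
  | zero => simp
  | add x y hx hy => simp only [add_tmul, map_add, hx, hy]
  | tmul c' d =>
    rw [LinearMap.rTensor_tmul, LinearMap.comp_apply, tmulRight_apply, retract_tmul, retract_tmul]
    change γ.contract _ (tmul k A (firstIncl C d (𝒞.comul c')) c) =
      γ.contract _ (tmul k A (𝒞.comul c') c) ⊗ₜ d
    induction 𝒞.comul c' using induction_on with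
    | zero => simp
    | add x y hx hy => simp only [map_add, TensorProduct.add_tmul, add_tmul, hx, hy]
    | tmul c c' => simp [TensorProduct.smul_tmul']

end Coring

end First

/-! ### The coaction on the second factor -/

section Second

variable [Module B D] [Module Bᵐᵒᵖ D]
  [SMulCommClass B Bᵐᵒᵖ D] [IsScalarTower k B D] [IsScalarTower k Bᵐᵒᵖ D]

variable (D) in
/-- The map `d ↦ c ⊗ d`. -/
def tensorLeftIncl (c : C) : D →ₗ[k] C ⊗[k] D := TensorProduct.mk k C D c

@[simp]
theorem tensorLeftIncl_apply (c : C) (d : D) : tensorLeftIncl (k := k) D c d = c ⊗ₜ d := rfl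

theorem tensorLeftIncl_rsmul (c : C) (b : B) (d : D) :
    tensorLeftIncl (k := k) D c (op b • d) = op b • tensorLeftIncl (k := k) D c d := rfl

/-- The map `D ⊗_B U → (C ⊗ D) ⊗_B U`, `d ⊗ u ↦ (c ⊗ d) ⊗ u`. -/
def secondIncl (U : Type*) [AddCommGroup U] [Module k U] [Module B U] (c : C) :
    BalTensor k B D U →ₗ[k] BalTensor k B (C ⊗[k] D) U :=
  map (tensorLeftIncl D c) LinearMap.id (tensorLeftIncl_rsmul c) id_lsmul

@[simp]
theorem secondIncl_tmul {U : Type*} [AddCommGroup U] [Module k U] [Module B U] (c : C) (d : D)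
    (u : U) : secondIncl U c (tmul k B d u) = tmul k B (c ⊗ₜ[k] d) u := by
  simp [secondIncl]

theorem secondIncl_add {U : Type*} [AddCommGroup U] [Module k U] [Module B U] (c c' : C)
    (x : BalTensor k B D U) : secondIncl U (c + c') x = secondIncl U c x + secondIncl U c' x := by
  induction x using induction_on with
  | zero => simp
  | add x y hx hy => simp only [map_add, hx, hy]; abel
  | tmul d u => simp [TensorProduct.add_tmul, add_tmul]

theorem secondIncl_smul {U : Type*} [AddCommGroup U] [Module k U] [Module B U] (r : k) (c : C)
    (x : BalTensor k B D U) : secondIncl U (r • c) x = r • secondIncl U c x := by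
  induction x using induction_on with
  | zero => simp
  | add x y hx hy => simp only [map_add, hx, hy, smul_add]
  | tmul d u => simp [← TensorProduct.smul_tmul', smul_tmul']

namespace Coring

/-- The coaction `c ⊗ d ↦ (c ⊗ d₁) ⊗ d₂` of `𝒟` on `C ⊗ D`. -/
def secondCoact (C : Type*) [AddCommGroup C] [Module k C] (𝒟 : Coring k B D) :
    C ⊗[k] D →ₗ[k] BalTensor k B (C ⊗[k] D) D :=
  TensorProduct.lift (LinearMap.mk₂ k (fun c d => secondIncl D c (𝒟.comul d))
    (fun c c' d => secondIncl_add c c' _) (fun r c d => secondIncl_smul r c _)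
    (fun c d d' => by rw [map_add, map_add]) (fun r c d => by rw [map_smul, map_smul]))

@[simp]
theorem secondCoact_tmul (𝒟 : Coring k B D) (c : C) (d : D) :
    𝒟.secondCoact C (c ⊗ₜ[k] d) = secondIncl D c (𝒟.comul d) := rfl

theorem isColinear_tensorLeftIncl (𝒟 : Coring k B D) (c : C) :
    IsColinear 𝒟.comul (𝒟.secondCoact C) (tensorLeftIncl D c) :=
  ⟨tensorLeftIncl_rsmul c, fun _ => rfl⟩

/-- As a `D`-comodule, `C ⊗ D` is generated by the images of the colinear maps `d ↦ c ⊗ d`, so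
colinearity can be tested after composing with them. -/
theorem isColinear_of_comp_tensorLeftIncl (𝒟 : Coring k B D) {M : Type*} [AddCommGroup M]
    [Module k M] [Module Bᵐᵒᵖ M] {ρ : M →ₗ[k] BalTensor k B M D} {g : C ⊗[k] D →ₗ[k] M}
    (h : ∀ c, IsColinear 𝒟.comul ρ (g ∘ₗ tensorLeftIncl D c)) :
    IsColinear (𝒟.secondCoact C) ρ g := by
  have hlin : ∀ (b : B) x, g (op b • x) = op b • g x := by
    intro b x
    induction x using TensorProduct.induction_on with
    | zero => simp
    | add x y hx hy => simp only [smul_add, map_add, hx, hy]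
    | tmul c d => exact (h c).1 b d
  refine ⟨hlin, fun x => ?_⟩
  induction x using TensorProduct.induction_on with
  | zero => simp
  | add x y hx hy => simp only [map_add, hx, hy]
  | tmul c d =>
    obtain ⟨_, hc⟩ := h c
    refine (hc d).trans ?_
    rw [secondCoact_tmul]
    induction 𝒟.comul d using induction_on with
    | zero => simp
    | add x y hx hy => simp only [map_add, hx, hy]
    | tmul d d' => simp

theorem isColinear_rTensor {C' : Type*} [AddCommGroup C'] [Module k C'] (𝒟 : Coring k B D)
    (g : C →ₗ[k] C') : IsColinear (𝒟.secondCoact C) (𝒟.secondCoact C') (LinearMap.rTensor D g) :=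
  𝒟.isColinear_of_comp_tensorLeftIncl fun c => by
    have : LinearMap.rTensor D g ∘ₗ tensorLeftIncl D c = tensorLeftIncl D (g c) := by
      ext d
      simp
    rw [this]
    exact 𝒟.isColinear_tensorLeftIncl (g c)

end Coring

end Second

/-! ### Averaging a projection while keeping colinearity over the second factor -/

section Both

variable [Module A C] [Module Aᵐᵒᵖ C]
  [SMulCommClass A Aᵐᵒᵖ C] [IsScalarTower k A C] [IsScalarTower k Aᵐᵒᵖ C]
variable [Module B D] [Module Bᵐᵒᵖ D]
  [SMulCommClass B Bᵐᵒᵖ D] [IsScalarTower k B D] [IsScalarTower k Bᵐᵒᵖ D]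

/-- The right action of `A` on `C ⊗ D` touches only `C`, so multiplying by elements of `A` before
and after `f` is `D`-colinear. -/
theorem Coring.isColinear_sandwich (𝒟 : Coring k B D) {f : C ⊗[k] D →ₗ[k] C ⊗[k] D}
    (hf : IsColinear (𝒟.secondCoact C) (𝒟.secondCoact C) f) (t : A ⊗[k] A) :
    IsColinear (𝒟.secondCoact C) (𝒟.secondCoact C) (sandwich f t) := by
  induction t using TensorProduct.induction_on with
  | zero => rw [map_zero]; exact IsColinear.zero
  | add s t hs ht => rw [map_add]; exact hs.add ht
  | tmul x y =>
    exact (𝒟.isColinear_rTensor (Algebra.lsmul k k C (op y))).comp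
      (hf.comp (𝒟.isColinear_rTensor (Algebra.lsmul k k C (op x))))

theorem Coring.Cointegral.isColinear_average_second {𝒞 : Coring k A C} (γ : 𝒞.Cointegral)
    (𝒟 : Coring k B D) {f : C ⊗[k] D →ₗ[k] C ⊗[k] D} (hA : ∀ (a : A) m, f (op a • m) = op a • f m)
    (hf : IsColinear (𝒟.secondCoact C) (𝒟.secondCoact C) f) :
    IsColinear (𝒟.secondCoact C) (𝒟.secondCoact C) (γ.average (𝒞.firstComodule D) f hA) := by
  refine 𝒟.isColinear_of_comp_tensorLeftIncl fun c => ?_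
  -- The element `Δ c` is replaced by an arbitrary `x` so that `x = c' ⊗ c''` can be assumed. The
  -- map is then `d ↦ c' ⊗ d`, followed by `f` and a map acting on the first factor alone, all three
  -- `D`-colinear.
  have key : ∀ x : BalTensor k A C C, ∃ w : D →ₗ[k] C ⊗[k] D,
      IsColinear 𝒟.comul (𝒟.secondCoact C) w ∧ ∀ d, w d = γ.retract (𝒞.firstComodule D)
        (map f LinearMap.id hA id_lsmul (firstIncl C d x)) := by
    intro x
    induction x using induction_on with
    | zero => exact ⟨0, IsColinear.zero, by simp⟩
    | add x y hx hy =>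
      obtain ⟨w, hw, hw'⟩ := hx
      obtain ⟨v, hv, hv'⟩ := hy
      exact ⟨w + v, hw.add hv, fun d => by simp only [map_add, LinearMap.add_apply, hw', hv']⟩
    | tmul c' c'' =>
      refine ⟨_, ((𝒟.isColinear_rTensor (γ.retract 𝒞.regular ∘ₗ tmulRight k A C c'')).comp
        hf).comp (𝒟.isColinear_tensorLeftIncl c'), fun d => ?_⟩
      rw [firstIncl_tmul, map_tmul, LinearMap.id_apply, γ.retract_firstComodule_tmul]
      rfl
  obtain ⟨w, hw, hw'⟩ := key (𝒞.comul c)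
  have : γ.average (𝒞.firstComodule D) f hA ∘ₗ tensorLeftIncl D c = w :=
    LinearMap.ext fun d => (hw' d).symm
  rw [this]
  exact hw

/-- A submodule stable under both actions and both coactions has a complement of the same kind as
soon as it has a complement which is stable under the second action and coaction. -/
theorem Coring.exists_isCompl_of_second {𝒞 : Coring k A C} (hC : 𝒞.IsCoseparable)
    (hA : IsSeparableAlgebra k A) (𝒟 : Coring k B D) {N N' : Submodule k (C ⊗[k] D)}
    (hNA : RStable A N) (hNB : RStable B N) (hNC : CoStable (𝒞.firstCoact D) N)
    (hND : CoStable (𝒟.secondCoact C) N) (hB' : RStable B N')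
    (hD' : CoStable (𝒟.secondCoact C) N') (hc : IsCompl N N') :
    ∃ Q : Submodule k (C ⊗[k] D), RStable A Q ∧ RStable B Q ∧ CoStable (𝒞.firstCoact D) Q ∧
      CoStable (𝒟.secondCoact C) Q ∧ IsCompl N Q := by
  obtain ⟨γ⟩ := hC.exists_cointegral
  obtain ⟨e, he, hea⟩ := hA.exists_idempotent
  let p : C ⊗[k] D →ₗ[k] C ⊗[k] D := N.subtype ∘ₗ N.projectionOnto N' hc
  have hpN : ∀ n ∈ N, p n = n := fun n hn =>
    congrArg Subtype.val (Submodule.projectionOnto_apply_left hc ⟨n, hn⟩)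
  have hpN' : ∀ n ∈ N', p n = 0 := fun n hn =>
    congrArg Subtype.val (Submodule.projectionOnto_apply_right hc ⟨n, hn⟩)
  have hpmem : ∀ m, p m ∈ N := fun m => Subtype.property _
  have hp := IsColinear.of_isCompl hNB hB' hND hD' hpN hpN' hc.sup_eq_top
  -- `p` is only `B`-linear and `D`-colinear; `q` adds `A`-linearity, which is what averaging over
  -- the cointegral requires of its input.
  let q := sandwich p e
  have hqA : ∀ (a : A) m, q (op a • m) = op a • q m := fun a m => by
    rw [sandwich_rsmul, rsmul_sandwich, hea]
  have hq := 𝒟.isColinear_sandwich hp e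
  have hqN : ∀ n ∈ N, q n = n := fun n hn => by
    simpa [he] using sandwich_eq_self hNA hpN e hn
  have hqmem : ∀ m, q m ∈ N := sandwich_mem hNA hpmem e
  let f := γ.average (𝒞.firstComodule D) q hqA
  have hfC := IsColinear.id.sub (γ.isColinear_average (𝒞.firstComodule D) q hqA)
  have hfD := IsColinear.id.sub (γ.isColinear_average_second 𝒟 hqA hq)
  have hfN : ∀ n ∈ N, f n = n := fun n hn => γ.average_eq_self hNC hqN hn
  have hfmem : ∀ m, f m ∈ N := γ.average_mem hNA hNC hqmem
  -- The complement is the kernel of the idempotent `f`, presented as the image of `1 - f`: images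
  -- of colinear maps are costable without any flatness.
  refine ⟨(⊤ : Submodule k (C ⊗[k] D)).map (LinearMap.id - f), hfC.rStable_map fun _ _ _ => trivial,
    hfD.rStable_map fun _ _ _ => trivial, hfC.coStable_map ?_, hfD.coStable_map ?_, ?_, ?_⟩
  · intro m _
    change (𝒞.firstCoact D) m ∈ _
    induction (𝒞.firstCoact D) m using induction_on with
    | zero => exact zero_mem _
    | add x y hx hy => exact add_mem hx hy
    | tmul m c => exact tmul_mem_tensorSpan Submodule.mem_top c
  · intro m _
    induction (𝒟.secondCoact C) m using induction_on with
    | zero => exact zero_mem _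
    | add x y hx hy => exact add_mem hx hy
    | tmul m c => exact tmul_mem_tensorSpan Submodule.mem_top c
  · rw [Submodule.disjoint_def]
    rintro _ hx ⟨m, -, rfl⟩
    have h₁ := hfN _ hx
    rw [LinearMap.sub_apply, map_sub, LinearMap.id_apply, hfN _ (hfmem m), sub_self] at h₁
    exact h₁.symm
  · rw [codisjoint_iff, eq_top_iff]
    intro m _
    refine Submodule.mem_sup.2 ⟨f m, hfmem m, m - f m, ⟨m, trivial, rfl⟩, ?_⟩
    abel

end Both

end TensorCoaction

/-! ## Tensoring over `A ⊗ B` in two steps -/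

namespace BalTensor

section OuterAction

variable {k : Type*} [CommRing k] {A : Type*} [Ring A] {B : Type*} [Ring B] [Algebra k B]
variable {X : Type*} [AddCommGroup X] [Module k X] [Module Aᵐᵒᵖ X] [Module Bᵐᵒᵖ X]
  [SMulCommClass Aᵐᵒᵖ Bᵐᵒᵖ X] [IsScalarTower k Bᵐᵒᵖ X]
variable {C : Type*} [AddCommGroup C] [Module k C] [Module A C]

/-- The right action `(x ⊗ c) b = (x b) ⊗ c` on `X ⊗_A C`. -/
instance (priority := 40) outerRightModule : Module Bᵐᵒᵖ (BalTensor k A X C) where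
  smul b := map (Algebra.lsmul k k X b) LinearMap.id
    (fun a x => by simpa using (smul_comm (op a) b x).symm) (fun _ _ => rfl)
  one_smul x := LinearMap.congr_fun (f := map (Algebra.lsmul k k X (1 : Bᵐᵒᵖ)) LinearMap.id _ _)
    (g := LinearMap.id) (hom_ext fun m n => by simp) x
  mul_smul a b x := LinearMap.congr_fun
    (f := map (Algebra.lsmul k k X (a * b)) LinearMap.id _ _)
    (g := map (Algebra.lsmul k k X a) LinearMap.id
        (fun c x => by simpa using (smul_comm (op c) a x).symm) (fun _ _ => rfl) ∘ₗ
      map (Algebra.lsmul k k X b) LinearMap.id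
        (fun c x => by simpa using (smul_comm (op c) b x).symm) (fun _ _ => rfl))
    (hom_ext fun m n => by simp) x
  smul_zero a := map_zero _
  smul_add a := map_add _
  add_smul a b x := LinearMap.congr_fun
    (f := map (Algebra.lsmul k k X (a + b)) LinearMap.id _ _)
    (g := map (Algebra.lsmul k k X a) LinearMap.id
        (fun c x => by simpa using (smul_comm (op c) a x).symm) (fun _ _ => rfl) +
      map (Algebra.lsmul k k X b) LinearMap.id
        (fun c x => by simpa using (smul_comm (op c) b x).symm) (fun _ _ => rfl))
    (hom_ext fun m n => by simp [add_tmul]) x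
  zero_smul x := LinearMap.congr_fun
    (f := map (Algebra.lsmul k k X (0 : Bᵐᵒᵖ)) LinearMap.id _ _) (g := 0)
    (hom_ext fun m n => by simp) x

@[simp]
theorem outer_rsmul_tmul (b : Bᵐᵒᵖ) (x : X) (c : C) :
    b • tmul k A x c = tmul k A (b • x) c :=
  map_tmul _ _ _ _ _ _

instance (priority := 40) outerScalarTower : IsScalarTower k Bᵐᵒᵖ (BalTensor k A X C) where
  smul_assoc r b y := by
    induction y using induction_on with
    | zero => simp
    | tmul x c => simp only [outer_rsmul_tmul, smul_assoc, smul_tmul']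
    | add x y hx hy => simp only [smul_add, hx, hy]

end OuterAction

section TwoStep

variable {k : Type*} [CommRing k] {A : Type*} [Ring A] [Algebra k A] {B : Type*} [Ring B]
  [Algebra k B]
variable {X : Type*} [AddCommGroup X] [Module k X] [Module Aᵐᵒᵖ X] [Module Bᵐᵒᵖ X]
  [SMulCommClass Aᵐᵒᵖ Bᵐᵒᵖ X] [IsScalarTower k Aᵐᵒᵖ X] [IsScalarTower k Bᵐᵒᵖ X]
  [Module (A ⊗[k] B)ᵐᵒᵖ X]
variable {Y : Type*} [AddCommGroup Y] [Module k Y] [Module Aᵐᵒᵖ Y] [Module Bᵐᵒᵖ Y]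
  [SMulCommClass Aᵐᵒᵖ Bᵐᵒᵖ Y] [IsScalarTower k Aᵐᵒᵖ Y] [IsScalarTower k Bᵐᵒᵖ Y]
  [Module (A ⊗[k] B)ᵐᵒᵖ Y]
variable {C : Type*} [AddCommGroup C] [Module k C] [Module A C] [IsScalarTower k A C]
variable {D : Type*} [AddCommGroup D] [Module k D] [Module B D] [IsScalarTower k B D]

variable (k A B X) in
/-- The action of `A ⊗ B` on `X` is the one determined by the commuting actions of `A` and `B`. -/
def CompatibleActions : Prop :=
  ∀ (a : A) (b : B) (x : X), op (a ⊗ₜ[k] b) • x = op a • op b • x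

/-- The map `X ⊗_{A ⊗ B} (C ⊗ D) → (X ⊗_A C) ⊗_B D`, `x ⊗ (c ⊗ d) ↦ (x ⊗ c) ⊗ d`. -/
def toTwoStep (hX : CompatibleActions k A B X) :
    BalTensor k (A ⊗[k] B) X (C ⊗[k] D) →ₗ[k] BalTensor k B (BalTensor k A X C) D :=
  lift (LinearMap.mk₂ k
    (fun x => TensorProduct.lift (LinearMap.mk₂ k (fun c d => tmul k B (tmul k A x c) d)
      (fun c c' d => by rw [tmul_add, add_tmul])
      (fun r c d => by rw [tmul_smul, smul_tmul'])
      (fun c d d' => by rw [tmul_add])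
      (fun r c d => by rw [tmul_smul])))
    (fun x x' y => by
      induction y using TensorProduct.induction_on with
      | zero => simp
      | add y z hy hz => simp only [map_add, hy, hz]; abel
      | tmul c d => simp [add_tmul])
    (fun r x y => by
      induction y using TensorProduct.induction_on with
      | zero => simp
      | add y z hy hz => simp only [map_add, hy, hz, smul_add]
      | tmul c d => simp [smul_tmul'])
    (fun x y y' => map_add _ _ _) (fun r x y => map_smul _ _ _))
    (by
      intro t x y
      simp only [LinearMap.mk₂_apply]
      induction y using TensorProduct.induction_on with
      | zero => simp
      | add y z hy hz => simp only [smul_add, map_add, hy, hz]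
      | tmul c d =>
        induction t using TensorProduct.induction_on with
        | zero => simp
        | add s t hs ht =>
          rw [add_smul, map_add, ← hs, ← ht]
          simp [add_smul, add_tmul]
        | tmul a b =>
          simp only [tensor_lsmul_tmul, TensorProduct.lift.tmul, LinearMap.mk₂_apply]
          rw [hX, ← smul_tmul (A := B), outer_rsmul_tmul, ← smul_tmul (A := A)])

@[simp]
theorem toTwoStep_tmul (hX : CompatibleActions k A B X) (x : X) (c : C) (d : D) :
    toTwoStep hX (tmul k (A ⊗[k] B) x (c ⊗ₜ[k] d)) = tmul k B (tmul k A x c) d :=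
  lift_tmul _ _ _ _

/-- The map `X ⊗_A C → X ⊗_{A ⊗ B} (C ⊗ D)`, `x ⊗ c ↦ x ⊗ (c ⊗ d)`. -/
def insertRight (hX : CompatibleActions k A B X) (d : D) :
    BalTensor k A X C →ₗ[k] BalTensor k (A ⊗[k] B) X (C ⊗[k] D) :=
  lift (LinearMap.mk₂ k (fun x c => tmul k (A ⊗[k] B) x (c ⊗ₜ[k] d))
    (fun x x' c => by rw [add_tmul]) (fun r x c => by rw [smul_tmul'])
    (fun x c c' => by rw [TensorProduct.add_tmul, tmul_add])
    (fun r x c => by rw [← TensorProduct.smul_tmul', tmul_smul]))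
    (by
      intro a x c
      have h := smul_tmul (k := k) (a ⊗ₜ[k] (1 : B)) x (c ⊗ₜ[k] d)
      rw [hX, op_one, one_smul, tensor_lsmul_tmul, one_smul] at h
      exact h)

@[simp]
theorem insertRight_tmul (hX : CompatibleActions k A B X) (x : X) (c : C) (d : D) :
    insertRight hX d (tmul k A x c) = tmul k (A ⊗[k] B) x (c ⊗ₜ[k] d) :=
  lift_tmul _ _ _ _

/-- The map `(X ⊗_A C) ⊗_B D → X ⊗_{A ⊗ B} (C ⊗ D)`, `(x ⊗ c) ⊗ d ↦ x ⊗ (c ⊗ d)`. -/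
def ofTwoStep (hX : CompatibleActions k A B X) :
    BalTensor k B (BalTensor k A X C) D →ₗ[k] BalTensor k (A ⊗[k] B) X (C ⊗[k] D) :=
  lift (LinearMap.mk₂ k (fun y d => insertRight hX d y)
    (fun y y' d => map_add _ _ _) (fun r y d => map_smul _ _ _)
    (fun y d d' => by
      induction y using induction_on with
      | zero => simp
      | add y z hy hz => simp only [map_add, hy, hz]; abel
      | tmul x c => simp [TensorProduct.tmul_add, tmul_add])
    (fun r y d => by
      induction y using induction_on with
      | zero => simp
      | add y z hy hz => simp only [map_add, hy, hz, smul_add]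
      | tmul x c => simp [tmul_smul]))
    (by
      intro b y d
      simp only [LinearMap.mk₂_apply]
      induction y using induction_on with
      | zero => simp
      | add y z hy hz => simp only [smul_add, map_add, hy, hz]
      | tmul x c =>
        have h := smul_tmul (k := k) ((1 : A) ⊗ₜ[k] b) x (c ⊗ₜ[k] d)
        rw [hX, op_one, one_smul, tensor_lsmul_tmul, one_smul] at h
        simpa using h)

@[simp]
theorem ofTwoStep_tmul (hX : CompatibleActions k A B X) (y : BalTensor k A X C) (d : D) :
    ofTwoStep hX (tmul k B y d) = insertRight hX d y :=
  lift_tmul _ _ _ _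

theorem bal_tensor_hom_ext {P : Type*} [AddCommGroup P] [Module k P]
    {f g : BalTensor k (A ⊗[k] B) X (C ⊗[k] D) →ₗ[k] P}
    (h : ∀ x c d, f (tmul k (A ⊗[k] B) x (c ⊗ₜ[k] d)) = g (tmul k (A ⊗[k] B) x (c ⊗ₜ[k] d))) :
    f = g :=
  hom_ext fun x y => by
    induction y using TensorProduct.induction_on with
    | zero => simp
    | add y z hy hz => simp only [tmul_add, map_add, hy, hz]
    | tmul c d => exact h x c d

theorem ofTwoStep_toTwoStep (hX : CompatibleActions k A B X)
    (x : BalTensor k (A ⊗[k] B) X (C ⊗[k] D)) : ofTwoStep hX (toTwoStep hX x) = x :=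
  LinearMap.congr_fun (f := ofTwoStep hX ∘ₗ toTwoStep hX) (g := LinearMap.id)
    (bal_tensor_hom_ext fun x c d => by simp) x

end TwoStep

section Flat

variable {k : Type u} [CommRing k] {A : Type u} [Ring A] [Algebra k A] {B : Type u} [Ring B]
  [Algebra k B]
variable {C : Type u} [AddCommGroup C] [Module k C] [Module A C] [IsScalarTower k A C]
variable {D : Type u} [AddCommGroup D] [Module k D] [Module B D] [IsScalarTower k B D]

theorem map_injective_of_compatibleActions (hC : IsLeftFlat k A C) (hD : IsLeftFlat k B D)
    {X : Type u} [AddCommGroup X] [Module k X] [Module Aᵐᵒᵖ X] [Module Bᵐᵒᵖ X]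
    [SMulCommClass Aᵐᵒᵖ Bᵐᵒᵖ X] [IsScalarTower k Aᵐᵒᵖ X] [IsScalarTower k Bᵐᵒᵖ X]
    [Module (A ⊗[k] B)ᵐᵒᵖ X]
    {Y : Type u} [AddCommGroup Y] [Module k Y] [Module Aᵐᵒᵖ Y] [Module Bᵐᵒᵖ Y]
    [SMulCommClass Aᵐᵒᵖ Bᵐᵒᵖ Y] [IsScalarTower k Aᵐᵒᵖ Y] [IsScalarTower k Bᵐᵒᵖ Y]
    [Module (A ⊗[k] B)ᵐᵒᵖ Y]
    (hX : CompatibleActions k A B X) (hY : CompatibleActions k A B Y) (f : X →ₗ[k] Y)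
    (hf : ∀ (t : A ⊗[k] B) x, f (op t • x) = op t • f x) (hinj : Function.Injective f) :
    Function.Injective (map f (LinearMap.id : C ⊗[k] D →ₗ[k] C ⊗[k] D) hf id_lsmul) := by
  have hfA : ∀ (a : A) x, f (op a • x) = op a • f x := fun a x => by
    have h := hf (a ⊗ₜ 1) x
    rwa [hX, hY, op_one, one_smul, one_smul] at h
  have hfB : ∀ (b : B) x, f (op b • x) = op b • f x := fun b x => by
    have h := hf (1 ⊗ₜ b) x
    rwa [hX, hY, op_one, one_smul, one_smul] at h
  have h₁ := hC X Y f hfA hinj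
  have hlin : ∀ (b : B) (y : BalTensor k A X C),
      map f (LinearMap.id : C →ₗ[k] C) hfA id_lsmul (op b • y) =
        op b • map f (LinearMap.id : C →ₗ[k] C) hfA id_lsmul y := by
    intro b y
    induction y using induction_on with
    | zero => simp
    | add y z hy hz => simp only [smul_add, map_add, hy, hz]
    | tmul x c => simp [hfB]
  have h₂ := hD _ _ (map f (LinearMap.id : C →ₗ[k] C) hfA id_lsmul) hlin h₁
  have hnat : toTwoStep hY ∘ₗ map f (LinearMap.id : C ⊗[k] D →ₗ[k] C ⊗[k] D) hf id_lsmul =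
      map (map f (LinearMap.id : C →ₗ[k] C) hfA id_lsmul) (LinearMap.id : D →ₗ[k] D) hlin
        id_lsmul ∘ₗ toTwoStep hX :=
    bal_tensor_hom_ext fun x c d => by simp
  intro x x' hxx
  have e := congrArg (toTwoStep hY) hxx
  have e₁ := LinearMap.congr_fun hnat x
  have e₂ := LinearMap.congr_fun hnat x'
  rw [LinearMap.comp_apply, LinearMap.comp_apply] at e₁ e₂
  rw [e₁, e₂] at e
  -- A left inverse of `toTwoStep` suffices: it transfers injectivity from the iterated tensor
  -- product.
  rw [← ofTwoStep_toTwoStep hX x, ← ofTwoStep_toTwoStep hX x', h₂ e]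

/-- The tensor product of flat modules is flat over the tensor product of the algebras. -/
theorem isLeftFlat_tensor (hC : IsLeftFlat k A C) (hD : IsLeftFlat k B D) :
    IsLeftFlat k (A ⊗[k] B) (C ⊗[k] D) := by
  intro X Y _ _ _ _ _ _ _ _ f hf hinj
  let iA : Aᵐᵒᵖ →ₐ[k] (A ⊗[k] B)ᵐᵒᵖ := AlgHom.op Algebra.TensorProduct.includeLeft
  let iB : Bᵐᵒᵖ →ₐ[k] (A ⊗[k] B)ᵐᵒᵖ := AlgHom.op Algebra.TensorProduct.includeRight
  have hcomm : ∀ (a : Aᵐᵒᵖ) (b : Bᵐᵒᵖ), iA a * iB b = iB b * iA a := fun a b => by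
    refine unop_injective ?_
    change (1 ⊗ₜ[k] unop b) * (unop a ⊗ₜ[k] 1) = (unop a ⊗ₜ[k] 1) * (1 ⊗ₜ[k] unop b)
    simp
  -- An arbitrary right `A ⊗ B`-module acquires commuting actions of `A` and `B` along the two
  -- inclusions into `A ⊗ B`.
  let : Module Aᵐᵒᵖ X := Module.compHom X iA.toRingHom
  let : Module Aᵐᵒᵖ Y := Module.compHom Y iA.toRingHom
  let : Module Bᵐᵒᵖ X := Module.compHom X iB.toRingHom
  let : Module Bᵐᵒᵖ Y := Module.compHom Y iB.toRingHom
  have hAX : ∀ (a : Aᵐᵒᵖ) (x : X), a • x = iA a • x := fun _ _ => rfl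
  have hAY : ∀ (a : Aᵐᵒᵖ) (x : Y), a • x = iA a • x := fun _ _ => rfl
  have hBX : ∀ (a : Bᵐᵒᵖ) (x : X), a • x = iB a • x := fun _ _ => rfl
  have hBY : ∀ (a : Bᵐᵒᵖ) (x : Y), a • x = iB a • x := fun _ _ => rfl
  have : IsScalarTower k Aᵐᵒᵖ X := ⟨fun r a x => by rw [hAX, hAX, map_smul, smul_assoc]⟩
  have : IsScalarTower k Aᵐᵒᵖ Y := ⟨fun r a x => by rw [hAY, hAY, map_smul, smul_assoc]⟩
  have : IsScalarTower k Bᵐᵒᵖ X := ⟨fun r a x => by rw [hBX, hBX, map_smul, smul_assoc]⟩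
  have : IsScalarTower k Bᵐᵒᵖ Y := ⟨fun r a x => by rw [hBY, hBY, map_smul, smul_assoc]⟩
  have : SMulCommClass Aᵐᵒᵖ Bᵐᵒᵖ X :=
    ⟨fun a b x => by rw [hAX, hBX, hBX, hAX, smul_smul, smul_smul, hcomm]⟩
  have : SMulCommClass Aᵐᵒᵖ Bᵐᵒᵖ Y :=
    ⟨fun a b x => by rw [hAY, hBY, hBY, hAY, smul_smul, smul_smul, hcomm]⟩
  have hmul : ∀ (a : A) (b : B), op (a ⊗ₜ[k] b) = iA (op a) * iB (op b) := fun a b => by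
    refine unop_injective ?_
    change a ⊗ₜ[k] b = (1 ⊗ₜ[k] b) * (a ⊗ₜ[k] 1)
    simp
  exact map_injective_of_compatibleActions hC hD
    (fun a b x => by rw [hAX, hBX, hmul, mul_smul]) (fun a b x => by rw [hAY, hBY, hmul, mul_smul])
    f hf hinj

end Flat

end BalTensor

/-! ## Subcomodules of the tensor product of two corings -/

section TensorSubcomodule

open BalTensor

section General

variable {k : Type*} [CommRing k] {A : Type*} [Ring A] [Algebra k A]
  {B : Type*} [Ring B] [Algebra k B]
variable {C : Type*} [AddCommGroup C] [Module k C] [Module A C] [Module Aᵐᵒᵖ C]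
  [SMulCommClass A Aᵐᵒᵖ C] [IsScalarTower k A C] [IsScalarTower k Aᵐᵒᵖ C]
variable {D : Type*} [AddCommGroup D] [Module k D] [Module B D] [Module Bᵐᵒᵖ D]
  [SMulCommClass B Bᵐᵒᵖ D] [IsScalarTower k B D] [IsScalarTower k Bᵐᵒᵖ D]

instance (priority := 40) tensorFirstSecondSMulComm : SMulCommClass Aᵐᵒᵖ Bᵐᵒᵖ (C ⊗[k] D) where
  smul_comm a b x := by
    induction x using TensorProduct.induction_on with
    | zero => simp
    | add x y hx hy => simp only [smul_add, hx, hy]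
    | tmul c d => simp [TensorProduct.smul_tmul']

variable (k A B C D) in
theorem compatibleActions_tensor : CompatibleActions k A B (C ⊗[k] D) := by
  intro a b x
  induction x using TensorProduct.induction_on with
  | zero => simp
  | add x y hx hy => simp only [smul_add, hx, hy]
  | tmul c d => simp [TensorProduct.smul_tmul']

theorem rStable_first {N : Submodule k (C ⊗[k] D)} (hN : RStable (A ⊗[k] B) N) :
    RStable A N := by
  intro a n hn
  have h := hN (a ⊗ₜ 1) n hn
  rwa [compatibleActions_tensor, op_one, one_smul] at h

theorem rStable_second {N : Submodule k (C ⊗[k] D)} (hN : RStable (A ⊗[k] B) N) :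
    RStable B N := by
  intro b n hn
  have h := hN (1 ⊗ₜ b) n hn
  rwa [compatibleActions_tensor, op_one, one_smul] at h

theorem rStable_tensor {N : Submodule k (C ⊗[k] D)} (hA : RStable A N) (hB : RStable B N) :
    RStable (A ⊗[k] B) N := by
  intro t n hn
  induction t using TensorProduct.induction_on with
  | zero => simp
  | add s t hs ht => rw [op_add, add_smul]; exact add_mem hs ht
  | tmul a b =>
    rw [compatibleActions_tensor]
    exact hA a _ (hB b n hn)

theorem rStable_restrictScalars {M : Type*} [AddCommGroup M] [Module k M] [Module Aᵐᵒᵖ M]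
    [IsScalarTower k Aᵐᵒᵖ M] (N : Submodule Aᵐᵒᵖ M) : RStable A (N.restrictScalars k) :=
  fun a _ hn => N.smul_mem (op a) hn

variable (𝒞 : Coring k A C) (𝒟 : Coring k B D)

namespace Coring

theorem firstCoact_second_rsmul (b : B) (x : C ⊗[k] D) :
    𝒞.firstCoact D (op b • x) = op b • 𝒞.firstCoact D x := by
  induction x using TensorProduct.induction_on with
  | zero => simp
  | add x y hx hy => simp only [smul_add, map_add, hx, hy]
  | tmul c d =>
    rw [second_rsmul_tmul, firstCoact_tmul, firstCoact_tmul]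
    induction 𝒞.comul c using induction_on with
    | zero => simp
    | add x y hx hy => simp only [smul_add, map_add, hx, hy]
    | tmul c c' => simp

/-- The coaction of `C ⊗ D` is the composite of the coactions of the two factors. -/
theorem tensorComul_eq (x : C ⊗[k] D) : tensorComul 𝒞 𝒟 x =
    ofTwoStep (compatibleActions_tensor k A B C D) (map (𝒞.firstCoact D) LinearMap.id
      (firstCoact_second_rsmul 𝒞) id_lsmul (𝒟.secondCoact C x)) := by
  induction x using TensorProduct.induction_on with
  | zero => simp
  | add x y hx hy => simp only [map_add, hx, hy]
  | tmul c d =>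
    rw [tensorComul_tmul, secondCoact_tmul]
    induction 𝒟.comul d using induction_on with
    | zero => simp
    | add x y hx hy => simp only [TensorProduct.tmul_add, map_add, hx, hy]
    | tmul d d' =>
      rw [secondIncl_tmul, map_tmul, ofTwoStep_tmul, firstCoact_tmul, LinearMap.id_apply]
      induction 𝒞.comul c using induction_on with
      | zero => simp
      | add x y hx hy => simp only [TensorProduct.add_tmul, map_add, hx, hy]
      | tmul c c' => simp

/-- Applying `ε_D` to the last factor of the coaction of `C ⊗ D` leaves the coaction of `C`, by
counitality of `D`. The formula on pure tensors shows that `τ` preserves tensor spans of `B`-stable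
submodules. -/
theorem exists_projection_first :
    ∃ τ : BalTensor k (A ⊗[k] B) (C ⊗[k] D) (C ⊗[k] D) →ₗ[k] BalTensor k A (C ⊗[k] D) C,
      (∀ m c d, τ (tmul k (A ⊗[k] B) m (c ⊗ₜ d)) = tmul k A (op (𝒟.counit d) • m) c) ∧
      ∀ x, τ (tensorComul 𝒞 𝒟 x) = 𝒞.firstCoact D x := by
  let τ := rid k B (BalTensor k A (C ⊗[k] D) C) ∘ₗ
    map LinearMap.id 𝒟.counit id_rsmul 𝒟.counit_lsmul ∘ₗ
    toTwoStep (compatibleActions_tensor k A B C D)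
  have hτ : ∀ m c d, τ (tmul k (A ⊗[k] B) m (c ⊗ₜ d)) = tmul k A (op (𝒟.counit d) • m) c :=
    fun m c d => by simp [τ]
  refine ⟨τ, hτ, fun x => ?_⟩
  induction x using TensorProduct.induction_on with
  | zero => simp
  | add x y hx hy => simp only [map_add, hx, hy]
  | tmul c d =>
    rw [tensorComul_tmul, firstCoact_tmul]
    conv_rhs => rw [← 𝒟.rid_comul d]
    induction 𝒞.comul c using induction_on with
    | zero => simp
    | add x y hx hy => simp only [TensorProduct.add_tmul, map_add, hx, hy]
    | tmul c c' =>
      induction 𝒟.comul d using induction_on with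
      | zero => simp
      | add x y hx hy => simp only [TensorProduct.tmul_add, map_add, firstIncl_add, hx, hy]
      | tmul d d' => rw [exchange_tmul, hτ]; simp

theorem exists_projection_second :
    ∃ τ : BalTensor k (A ⊗[k] B) (C ⊗[k] D) (C ⊗[k] D) →ₗ[k] BalTensor k B (C ⊗[k] D) D,
      (∀ m c d, τ (tmul k (A ⊗[k] B) m (c ⊗ₜ d)) = tmul k B (op (𝒞.counit c) • m) d) ∧
      ∀ x, τ (tensorComul 𝒞 𝒟 x) = 𝒟.secondCoact C x := by
  let r := rid k A (C ⊗[k] D) ∘ₗ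
    map (LinearMap.id : C ⊗[k] D →ₗ[k] C ⊗[k] D) 𝒞.counit id_rsmul 𝒞.counit_lsmul
  have hr : ∀ m c, r (tmul k A m c) = op (𝒞.counit c) • m := fun m c => by simp [r]
  have hlin : ∀ (b : B) y, r (op b • y) = op b • r y := by
    intro b y
    induction y using induction_on with
    | zero => simp
    | add y z hy hz => simp only [smul_add, map_add, hy, hz]
    | tmul m c => rw [outer_rsmul_tmul, hr, hr, smul_comm]
  let τ := map r (LinearMap.id : D →ₗ[k] D) hlin id_lsmul ∘ₗ
    toTwoStep (compatibleActions_tensor k A B C D)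
  have hτ : ∀ m c d, τ (tmul k (A ⊗[k] B) m (c ⊗ₜ d)) = tmul k B (op (𝒞.counit c) • m) d :=
    fun m c d => by simp [τ, hr]
  refine ⟨τ, hτ, fun x => ?_⟩
  induction x using TensorProduct.induction_on with
  | zero => simp
  | add x y hx hy => simp only [map_add, hx, hy]
  | tmul c d =>
    rw [tensorComul_tmul, secondCoact_tmul]
    conv_rhs => rw [← 𝒞.rid_comul c]
    induction 𝒞.comul c using induction_on with
    | zero =>
      have h := secondIncl_smul (0 : k) (0 : C) (𝒟.comul d)
      rw [zero_smul, zero_smul] at h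
      simp [h]
    | add x y hx hy => simp only [TensorProduct.add_tmul, map_add, secondIncl_add, hx, hy]
    | tmul c c' =>
      induction 𝒟.comul d using induction_on with
      | zero => simp
      | add x y hx hy => simp only [TensorProduct.tmul_add, map_add, hx, hy]
      | tmul d d' => rw [exchange_tmul, hτ]; simp [TensorProduct.smul_tmul']

/-- The projections `τ` recover each separate coaction from the joint one; conversely the joint
coaction is the composite of the two. -/
theorem coStable_tensorComul_iff {N : Submodule k (C ⊗[k] D)} (hN : RStable (A ⊗[k] B) N) :
    CoStable (tensorComul 𝒞 𝒟) N ↔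
      CoStable (𝒞.firstCoact D) N ∧ CoStable (𝒟.secondCoact C) N := by
  refine ⟨fun h => ⟨fun m hm => ?_, fun m hm => ?_⟩, fun h m hm => ?_⟩
  · obtain ⟨τ, hτ, hτ'⟩ := exists_projection_first 𝒞 𝒟
    rw [← hτ']
    refine tensorSpan_map_mem τ (fun n hn u => ?_) (h m hm)
    induction u using TensorProduct.induction_on with
    | zero => simp
    | add x y hx hy => rw [tmul_add, map_add]; exact add_mem hx hy
    | tmul c d => rw [hτ]; exact tmul_mem_tensorSpan (rStable_second hN _ n hn) c
  · obtain ⟨τ, hτ, hτ'⟩ := exists_projection_second 𝒞 𝒟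
    rw [← hτ']
    refine tensorSpan_map_mem τ (fun n hn u => ?_) (h m hm)
    induction u using TensorProduct.induction_on with
    | zero => simp
    | add x y hx hy => rw [tmul_add, map_add]; exact add_mem hx hy
    | tmul c d => rw [hτ]; exact tmul_mem_tensorSpan (rStable_first hN _ n hn) d
  · rw [tensorComul_eq]
    refine tensorSpan_map_mem (ofTwoStep (compatibleActions_tensor k A B C D) ∘ₗ
      map (𝒞.firstCoact D) LinearMap.id (firstCoact_second_rsmul 𝒞) id_lsmul)
      (fun n hn d => ?_) (h.2 m hm)
    rw [LinearMap.comp_apply, map_tmul, ofTwoStep_tmul]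
    refine tensorSpan_map_mem _ (fun n hn c => ?_) (h.1 n hn)
    rw [insertRight_tmul]
    exact tmul_mem_tensorSpan hn _

theorem isSubcomodule_tensor_iff (N : Submodule (A ⊗[k] B)ᵐᵒᵖ (C ⊗[k] D)) :
    (𝒞.tensor 𝒟).regular.IsSubcomodule N ↔
      CoStable (𝒞.firstCoact D) (N.restrictScalars k) ∧
        CoStable (𝒟.secondCoact C) (N.restrictScalars k) := by
  rw [← coStable_tensorComul_iff 𝒞 𝒟 (rStable_restrictScalars N), RightComodule.IsSubcomodule,
    range_map_subtype]
  rfl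

end Coring

end General

/-! ### Semisimplicity over the second coring, and the lattice of all subcomodules -/

section Semisimple

variable {k : Type u} [CommRing k] {A : Type u} [Ring A] [Algebra k A]
  {B : Type u} [Ring B] [Algebra k B]
variable {C : Type u} [AddCommGroup C] [Module k C]
variable {D : Type u} [AddCommGroup D] [Module k D] [Module B D] [Module Bᵐᵒᵖ D]
  [SMulCommClass B Bᵐᵒᵖ D] [IsScalarTower k B D] [IsScalarTower k Bᵐᵒᵖ D]

namespace Coring

/-- The subcomodules of `C ⊗ D` for the coaction of `𝒟` on the second factor. -/
def secondSubcomodules (C : Type u) [AddCommGroup C] [Module k C] (𝒟 : Coring k B D) :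
    Set (Submodule k (C ⊗[k] D)) :=
  {N | RStable B N ∧ CoStable (𝒟.secondCoact C) N}

/-- A subcomodule `L` of the image is the image of the part of its preimage inside `T`. By flatness
that part is a subcomodule of `T`, so it is `0` or `T`. The image itself may vanish, hence the
hypothesis `h0`. -/
theorem isSimpleIn_map_tensorLeftIncl {𝒟 : Coring k B D} (hflat : IsLeftFlat k B D)
    {T : Submodule Bᵐᵒᵖ D} (hT : 𝒟.regular.IsSimpleSubcomodule T) (c : C)
    (h0 : (T.restrictScalars k).map (tensorLeftIncl D c) ≠ ⊥) :
    IsSimpleIn (𝒟.secondSubcomodules C) ((T.restrictScalars k).map (tensorLeftIncl D c)) := by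
  have hc := 𝒟.isColinear_tensorLeftIncl c
  have hTB : RStable B (T.restrictScalars k) := rStable_restrictScalars T
  have hTD : CoStable 𝒟.comul (T.restrictScalars k) := fun m hm => by
    rw [← range_map_subtype]
    exact hT.1 m hm
  refine ⟨⟨hc.rStable_map hTB, hc.coStable_map hTD⟩, h0, fun L hL hmem => ?_⟩
  have hKB := (hc.rStable_comap hmem.1).inf hTB
  have hKD := (hc.coStable_comap hflat hmem.1 hmem.2).inf hflat (hc.rStable_comap hmem.1) hTB hTD
  have hLmap : L = (L.comap (tensorLeftIncl D c) ⊓ T.restrictScalars k).map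
      (tensorLeftIncl D c) := by
    refine le_antisymm (fun x hx => ?_) (Submodule.map_le_iff_le_comap.2 inf_le_left)
    obtain ⟨d, hd, rfl⟩ := hL hx
    exact ⟨d, ⟨hx, hd⟩, rfl⟩
  have hsub : 𝒟.regular.IsSubcomodule hKB.toSubmodule := fun m hm => by
    rw [range_map_subtype]
    exact hKD m hm
  rcases hT.2.2 hKB.toSubmodule (fun x hx => hx.2) hsub with h | h
  · left
    have h' : L.comap (tensorLeftIncl D c) ⊓ T.restrictScalars k = ⊥ :=
      congrArg (Submodule.restrictScalars k) h
    rw [hLmap, h', Submodule.map_bot]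
  · right
    have h' : L.comap (tensorLeftIncl D c) ⊓ T.restrictScalars k = T.restrictScalars k :=
      congrArg (Submodule.restrictScalars k) h
    rw [hLmap, h']

/-- Flatness of `D` over `B` gives intersections. The simple members generate because every `c ⊗ d`
lies in `c ⊗ D`, which is the sum of the images of the simple subcomodules of `D`. -/
theorem IsSemisimple.isSemisimpleFamily {𝒟 : Coring k B D} (hD : 𝒟.IsSemisimple) (C : Type u)
    [AddCommGroup C] [Module k C] : IsSemisimpleFamily (𝒟.secondSubcomodules C) where
  sSup_mem 𝓕 h := ⟨RStable.sSup fun N hN => (h hN).1, CoStable.sSup fun N hN => (h hN).2⟩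
  inf_mem N hN N' hN' := ⟨hN.1.inf hN'.1, hN.2.inf hD.1 hN.1 hN'.1 hN'.2⟩
  sSup_simple := by
    obtain ⟨hflat, S, hS, -, htop⟩ := hD
    have hS' : sSup (Submodule.restrictScalars k '' S) = ⊤ := by
      rw [← Submodule.restrictScalars_sSup, htop, Submodule.restrictScalars_top]
    have key : ∀ (c : C), ⊤ ≤ (sSup {N | IsSimpleIn (𝒟.secondSubcomodules C) N}).comap
        (tensorLeftIncl D c) := by
      intro c
      rw [← hS']
      refine sSup_le ?_
      rintro _ ⟨T, hT, rfl⟩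
      rw [← Submodule.map_le_iff_le_comap]
      by_cases h0 : (T.restrictScalars k).map (tensorLeftIncl D c) = ⊥
      · rw [h0]; exact bot_le
      · exact le_sSup (isSimpleIn_map_tensorLeftIncl hflat (hS T hT) c h0)
    rw [eq_top_iff]
    intro x _
    induction x using TensorProduct.induction_on with
    | zero => exact zero_mem _
    | add x y hx hy => exact add_mem (hx trivial) (hy trivial)
    | tmul c d => exact key c (Submodule.mem_top (x := d))

variable [Module A C] [Module Aᵐᵒᵖ C]
  [SMulCommClass A Aᵐᵒᵖ C] [IsScalarTower k A C] [IsScalarTower k Aᵐᵒᵖ C]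

/-- The complete lattice of subcomodules of `C ⊗ D`. -/
def tensorSubcomodules (𝒞 : Coring k A C) (hA : IsSeparableAlgebra k A) {𝒟 : Coring k B D}
    (hD : 𝒟.IsSemisimple) : CompleteSublattice (Submodule (A ⊗[k] B)ᵐᵒᵖ (C ⊗[k] D)) :=
  CompleteSublattice.mk' {N | (𝒞.tensor 𝒟).regular.IsSubcomodule N}
    (fun 𝓕 h𝓕 => by
      have h : ∀ N ∈ 𝓕, _ := fun N hN => (isSubcomodule_tensor_iff 𝒞 𝒟 N).1 (h𝓕 hN)
      refine (isSubcomodule_tensor_iff 𝒞 𝒟 _).2 ?_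
      rw [Submodule.restrictScalars_sSup]
      constructor <;> refine CoStable.sSup ?_ <;> rintro _ ⟨N, hN, rfl⟩
      exacts [(h N hN).1, (h N hN).2])
    (fun 𝓕 h𝓕 => by
      have h : ∀ N ∈ 𝓕, _ := fun N hN => (isSubcomodule_tensor_iff 𝒞 𝒟 N).1 (h𝓕 hN)
      have hst : ∀ N ∈ Submodule.restrictScalars k '' 𝓕, RStable (A ⊗[k] B) N := by
        rintro _ ⟨N, -, rfl⟩
        exact rStable_restrictScalars N
      have hmem : Submodule.restrictScalars k '' 𝓕 ⊆ 𝒟.secondSubcomodules C := by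
        rintro _ ⟨N, hN, rfl⟩
        exact ⟨rStable_second (rStable_restrictScalars N), (h N hN).2⟩
      refine (isSubcomodule_tensor_iff 𝒞 𝒟 _).2 ?_
      rw [Submodule.restrictScalars_sInf]
      -- For the `D`-coaction, the semisimple family is closed under intersections. For the
      -- `C`-coaction, separability of `A` is combined with the same family: subcomodules split off
      -- as `D`-comodules, hence over `k`.
      refine ⟨fun m hm => ?_, ((hD.isSemisimpleFamily C).sInf_mem hmem).2⟩
      refine hA.mem_tensorSpan_sInf (hD.isSemisimpleFamily C) hmem
        (fun N hN => rStable_first (hst N hN)) fun N hN => ?_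
      have hmN := (Submodule.mem_sInf.1 hm) N hN
      obtain ⟨N, hN, rfl⟩ := hN
      exact (h N hN).1 m hmN)

/-- A complement in the larger lattice of sub-`D`-comodules comes from semisimplicity of `D`; the
two averagings replace it by one that is a subcomodule over the tensor coring. -/
theorem complementedLattice_tensorSubcomodules {𝒞 : Coring k A C} (hA : IsSeparableAlgebra k A)
    (hC : 𝒞.IsCoseparable) {𝒟 : Coring k B D} (hD : 𝒟.IsSemisimple) :
    ComplementedLattice (𝒞.tensorSubcomodules hA hD) := by
  refine ⟨fun N => ?_⟩
  have hN := (isSubcomodule_tensor_iff 𝒞 𝒟 N.1).1 N.2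
  have hst : RStable (A ⊗[k] B) (N.1.restrictScalars k) := rStable_restrictScalars N.1
  obtain ⟨N', hN', hc⟩ := (hD.isSemisimpleFamily C).exists_isCompl
    (N := N.1.restrictScalars k) ⟨rStable_second hst, hN.2⟩
  obtain ⟨Q, hQA, hQB, hQC, hQD, hQ⟩ := exists_isCompl_of_second hC hA 𝒟 (rStable_first hst)
    (rStable_second hst) hN.1 hN.2 hN'.1 hN'.2 hc
  have hQst := rStable_tensor hQA hQB
  refine ⟨⟨hQst.toSubmodule, (isSubcomodule_tensor_iff 𝒞 𝒟 _).2 ⟨hQC, hQD⟩⟩, ?_, ?_⟩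
  · rw [disjoint_iff]
    refine Subtype.ext ?_
    exact Submodule.restrictScalars_injective k _ _ hQ.inf_eq_bot
  · rw [codisjoint_iff]
    refine Subtype.ext (Submodule.restrictScalars_injective k _ _ ?_)
    refine (Submodule.restrictScalars_sup k _ _).trans ?_
    exact hQ.sup_eq_top

end Coring

end Semisimple

end TensorSubcomodule

end

theorem mainTheorem2 {k : Type u} [CommRing k] {A : Type u} [Ring A] [Algebra k A]
    {C : Type u} [AddCommGroup C] [Module k C] [Module A C] [Module Aᵐᵒᵖ C]
    [SMulCommClass A Aᵐᵒᵖ C] [IsScalarTower k A C] [IsScalarTower k Aᵐᵒᵖ C]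
    (𝒞 : Coring k A C) (hA : IsSeparableAlgebra k A) (hC : 𝒞.IsCoseparable)
    (hflat : IsLeftFlat k A C)
    {B : Type u} [Ring B] [Algebra k B]
    {D : Type u} [AddCommGroup D] [Module k D] [Module B D] [Module Bᵐᵒᵖ D]
    [SMulCommClass B Bᵐᵒᵖ D] [IsScalarTower k B D] [IsScalarTower k Bᵐᵒᵖ D]
    (𝒟 : Coring k B D) (hD : 𝒟.IsSemisimple) :
    (𝒞.tensor 𝒟).IsSemisimple := by
  refine ⟨BalTensor.isLeftFlat_tensor hflat hD.1, ?_⟩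
  let L := 𝒞.tensorSubcomodules hA hD
  have : IsCompactlyGenerated L := L.isCompactlyGenerated_submodule
  have : ComplementedLattice L := Coring.complementedLattice_tensorSubcomodules hA hC hD
  -- In a complemented, compactly generated modular lattice the atoms join to the top, and an
  -- independent set of them already does. The atoms of `L` are the simple subcomodules.
  obtain ⟨s, hind, htop, hatom⟩ :=
    exists_sSupIndep_of_sSup_atoms_eq_top (sSup_atoms_eq_top (α := L))
  refine ⟨Subtype.val '' s, ?_, ?_, ?_⟩
  · rintro _ ⟨N, hN, rfl⟩
    have hN' := hatom hN
    refine ⟨N.2, fun h => hN'.1 (Subtype.ext h), fun K hK hsub => ?_⟩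
    rcases hN'.le_iff.1 (show (⟨K, hsub⟩ : L) ≤ N from hK) with h | h
    · exact Or.inl (congrArg Subtype.val h)
    · exact Or.inr (congrArg Subtype.val h)
  · rintro _ ⟨N, hN, rfl⟩
    -- Independence carries over to the lattice of submodules because meets and arbitrary joins in
    -- `L` are computed there.
    have h := congrArg Subtype.val (disjoint_iff.1 (hind hN))
    rw [disjoint_iff]
    have e : Subtype.val '' s \ {N.1} = Subtype.val '' (s \ {N}) := by
      rw [Set.image_sdiff Subtype.val_injective, Set.image_singleton]
    rw [e]
    exact h
  · exact congrArg Subtype.val htop
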